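/- Let $n\ge 1$, $\mathcal O=\mathbb C[[t]]$, $\mathcal P=t\mathcal O$, and let $\kappa$ be a multiple of the form $(X,Y)\mapsto 2n\,\mathrm{tr}(XY)-2\,\mathrm{tr}X\,\mathrm{tr}Y$ on $\mathfrak{gl}_n$. Let $\widehat{\mathfrak{gl}}_{n,\kappa}$ be the central extension of $\mathfrak{gl}_n((t))$ by $\mathbb C\mathbf 1$ with cocycle $(x\otimes f,y\otimes g)\mapsto-\kappa(x,y)\,\mathrm{Res}_{t=0}(f\,dg)$; in a $\widehat{\mathfrak{gl}}_{n,\kappa}$-module the element $\mathbf 1$ is required to act as the identity. Write $x[r]=x\otimes t^r$. **Segal–Sugawara vectors.** Let $\mathfrak g_-=t^{-1}\mathfrak{gl}_n[t^{-1}]$ and adjoin to $U(\mathfrak g_-)$ an element $\tau$ with $[\tau,x[r]]=-r\,x[r-1]$. Let $E[-1]$ be the matrix with entries $e_{ij}[-1]$ and put $\mathrm{cdet}\,A=\sum_\sigma \mathrm{sgn}(\sigma)\,a_{\sigma(1)1}\cdots a_{\sigma(n)n}$. The vectors $S_1,\dots,S_n\in U(\mathfrak g_-)$ are defined by $$\mathrm{cdet}(\tau+E[-1])=\tau^n+\tau^{n-1}S_1+\cdots+\tau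 S_{n-1}+S_n .$$ **Fourier coefficients.** A vector of a module is called smooth if it is annihilated by $t^K\mathfrak{gl}_n[[t]]$ for some $K$; the smooth vectors form a submodule, and a module is smooth if all its vectors are. Identify $U(\mathfrak g_-)$ with the affine vertex algebra $V_\kappa(\widehat{\mathfrak{gl}}_n)$. For $S\in U(\mathfrak g_-)$ and $N\in\mathbb Z$ the Fourier coefficient $S_{[N]}$ acts on every smooth module as the coefficient of $w^{-N-1}$ in the field $Y(S,w)$, where $Y(1,w)=\mathrm{id}$ and $Y(x[-k-1]S,w)=\frac1{k!}{:}\partial_w^k x(w)\,Y(S,w){:}$ with $x(w)=\sum_{s}x[s]w^{-s-1}$ for $x\in\mathfrak{gl}_n$, $k\ge0$. **Proposition.** Let $m\ge 0$ be an integer and let $\mathfrak k_m^0\subset\mathfrak{gl}_n(\mathcal O)$ be the space of matrices whose entries in the last row (including the corner $(n,n)$) lie in $\mathcal P^m$, whose remaining entries in the last column lie in $\mathcal O$, and whose other entries lie in $\mathcal P$ (for $m\ge1$ this is a Lie subalgebra). Let $v$ be a vector in a $\widehat{\mathfrak{gl}}_{n,\kappa}$-module that is annihilated by $\mathfrak k_m^0$.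 Then $v$ is smooth, and in the submodule of smooth vectors $$S_{\ell,[N]}\,v=0\qquad\text{for all }\ell\in\{1,\dots,n\}\text{ and all }N\ge m+\ell-1 .$$ -/

import Mathlib

namespace AffineGL

noncomputable section

open scoped Polynomial
open LieModule.Cohomology

attribute [local instance 100] LieRing.ofAssociativeRing LieAlgebra.ofAssociativeAlgebra

/-- The loop algebra `gl_n((t))`, i.e. `n × n` matrices over `ℂ((t))` with the commutator. -/
abbrev Loop (n : ℕ) : Type := Matrix (Fin n) (Fin n) (LaurentSeries ℂ)

theorem derivative_mul (f g : LaurentSeries ℂ) :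
    LaurentSeries.derivative ℂ (f * g)
      = f * LaurentSeries.derivative ℂ g + LaurentSeries.derivative ℂ f * g := by
  have key : ∀ h : LaurentSeries ℂ, ∃ th : LaurentSeries ℂ,
      (∀ k, th.coeff k = (k : ℂ) * h.coeff k) ∧ th.support ⊆ h.support ∧
      LaurentSeries.derivative ℂ h = HahnSeries.single (-1 : ℤ) (1 : ℂ) * th := by
    intro h
    have hs : (Function.support fun k : ℤ => (k : ℂ) * h.coeff k) ⊆ h.support := by
      intro k hk hk'
      exact hk (by simp [hk'])
    refine ⟨⟨fun k => (k : ℂ) * h.coeff k, h.isPWO_support.mono hs⟩, fun _ => rfl, hs, ?_⟩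
    ext k
    simp [HahnSeries.coeff_single_mul, LaurentSeries.hasseDeriv_coeff]
  obtain ⟨tf, hf1, hf2, hf3⟩ := key f
  obtain ⟨tg, hg1, hg2, hg3⟩ := key g
  obtain ⟨tp, hp1, -, hp3⟩ := key (f * g)
  have : tp = f * tg + tf * g := by
    ext k
    rw [hp1, HahnSeries.coeff_add, HahnSeries.coeff_mul_right' g.isPWO_support hg2,
      HahnSeries.coeff_mul_left' f.isPWO_support hf2, HahnSeries.coeff_mul, Finset.mul_sum,
      ← Finset.sum_add_distrib]
    refine Finset.sum_congr rfl fun ij hij => ?_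
    have : ij.1 + ij.2 = k := by simpa using (Finset.mem_antidiagonal.mp hij).2.2
    rw [hf1, hg1, ← this]
    push_cast
    ring
  rw [hf3, hg3, hp3, this]
  ring

instance : IsScalarTower ℂ (LaurentSeries ℂ) (LaurentSeries ℂ) :=
  ⟨fun a x y => by
    simp only [smul_eq_mul, ← HahnSeries.single_zero_mul_eq_smul, mul_assoc]⟩

instance : SMulCommClass ℂ (LaurentSeries ℂ) (LaurentSeries ℂ) :=
  ⟨fun a x y => by
    simp only [smul_eq_mul, ← HahnSeries.single_zero_mul_eq_smul, mul_left_comm]⟩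

instance (n : ℕ) : IsScalarTower ℂ (Loop n) (Loop n) :=
  ⟨fun a X Y => Matrix.smul_mul a X Y⟩

instance (n : ℕ) : SMulCommClass ℂ (Loop n) (Loop n) :=
  ⟨fun a X Y => (Matrix.mul_smul X a Y).symm⟩

instance (n : ℕ) : LieRing (Loop n) := LieRing.ofAssociativeRing

instance (n : ℕ) : LieAlgebra ℂ (Loop n) where
  lie_smul a X Y := by
    simp only [Ring.lie_def, mul_smul_comm, smul_mul_assoc, smul_sub]

/-- The entrywise derivative with respect to `t`. -/
def loopDeriv (n : ℕ) : Loop n →ₗ[ℂ] Loop n :=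
  (LaurentSeries.derivative ℂ (V := ℂ)).mapMatrix

theorem loopDeriv_mul {n : ℕ} (X Y : Loop n) :
    loopDeriv n (X * Y) = X * loopDeriv n Y + loopDeriv n X * Y := by
  ext1 i j
  simp only [loopDeriv, LinearMap.mapMatrix_apply, Matrix.map_apply, Matrix.mul_apply, map_sum,
    derivative_mul, Finset.sum_add_distrib, Matrix.add_apply]

theorem trace_loopDeriv {n : ℕ} (X : Loop n) :
    (loopDeriv n X).trace = LaurentSeries.derivative ℂ X.trace := by
  simp [loopDeriv, Matrix.trace, map_sum]

theorem residue_derivative (f : LaurentSeries ℂ) :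
    (LaurentSeries.derivative ℂ f).coeff (-1) = 0 := by
  simp [LaurentSeries.hasseDeriv_coeff]

/-- The `ℂ((t))`-bilinear extension of the Killing form
`(X, Y) ↦ 2 n tr (X Y) - 2 tr X tr Y` of `gl_n`. -/
def killing (n : ℕ) (X Y : Loop n) : LaurentSeries ℂ :=
  2 * (n : LaurentSeries ℂ) * (X * Y).trace - 2 * X.trace * Y.trace

theorem killing_smul_left {n : ℕ} (a : ℂ) (X Y : Loop n) :
    killing n (a • X) Y = a • killing n X Y := by
  rw [killing, killing, smul_mul_assoc, Matrix.trace_smul, Matrix.trace_smul, mul_smul_comm,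
    mul_smul_comm, smul_mul_assoc, smul_sub]

theorem killing_smul_right {n : ℕ} (a : ℂ) (X Y : Loop n) :
    killing n X (a • Y) = a • killing n X Y := by
  rw [killing, killing, mul_smul_comm, Matrix.trace_smul, Matrix.trace_smul, mul_smul_comm,
    mul_smul_comm, smul_sub]

/-- The bilinear form `(X, Y) ↦ - Res κ(X, dY)` where `κ` is `c` times the Killing form; on
`X = x ⊗ f`, `Y = y ⊗ g` it is `- κ(x, y) Res (f g')`. The residue is the coefficient of `t⁻¹`. -/
def affineCochainAux (n : ℕ) (c : ℂ) : Loop n →ₗ[ℂ] Loop n →ₗ[ℂ] ℂ :=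
  LinearMap.mk₂ ℂ (fun X Y => -(c * (killing n X (loopDeriv n Y)).coeff (-1)))
    (fun X Y Z => by simp [killing, add_mul, mul_add]; ring)
    (fun a X Y => by rw [killing_smul_left]; simp; ring)
    (fun X Y Z => by simp [killing, mul_add]; ring)
    (fun a X Y => by rw [map_smul, killing_smul_right]; simp; ring)

theorem killing_self {n : ℕ} (X : Loop n) : (killing n X (loopDeriv n X)).coeff (-1) = 0 := by
  have h : 2 * killing n X (loopDeriv n X)
      = LaurentSeries.derivative ℂ (killing n X X) := by
    have h2 : ∀ a b : LaurentSeries ℂ, LaurentSeries.derivative ℂ (2 * a) = 2 * LaurentSeries.derivative ℂ a := by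
      intro a _
      rw [two_mul, map_add, two_mul]
    have e1 : LaurentSeries.derivative ℂ (2 * (n : LaurentSeries ℂ) * (X * X).trace)
       = 2 * (n : LaurentSeries ℂ) * LaurentSeries.derivative ℂ (X * X).trace := by
      have : ∀ a : LaurentSeries ℂ, 2 * (n : LaurentSeries ℂ) * a = (2 * n) • a := by
        intro a; simp
      rw [this, this, map_nsmul]
    have e2 : LaurentSeries.derivative ℂ (2 * X.trace * X.trace)
       = 2 * LaurentSeries.derivative ℂ (X.trace * X.trace) := by
      rw [mul_assoc, two_mul, map_add, two_mul]
    rw [killing, killing, map_sub, e1, e2, ← trace_loopDeriv, loopDeriv_mul, derivative_mul,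
      Matrix.trace_add, trace_loopDeriv, Matrix.trace_mul_comm (loopDeriv n X) X]
    ring
  have h3 := congrArg (fun f => HahnSeries.coeff f (-1)) h
  simp only [residue_derivative, two_mul, HahnSeries.coeff_add] at h3
  linear_combination h3 / 2

theorem killing_skew {n : ℕ} (X Y : Loop n) :
    (killing n X (loopDeriv n Y)).coeff (-1) = -(killing n Y (loopDeriv n X)).coeff (-1) := by
  have h := killing_self (X + Y)
  have e : killing n (X + Y) (loopDeriv n (X + Y)) = killing n X (loopDeriv n X)
      + killing n X (loopDeriv n Y) + killing n Y (loopDeriv n X)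
      + killing n Y (loopDeriv n Y) := by
    simp only [killing, map_add, add_mul, mul_add, Matrix.trace_add]
    ring
  rw [e] at h
  simp only [HahnSeries.coeff_add, killing_self] at h
  linear_combination h

theorem killing_jacobi {n : ℕ} (X Y Z : Loop n) :
    (killing n ⁅X, Y⁆ (loopDeriv n Z)).coeff (-1) + (killing n ⁅Y, Z⁆ (loopDeriv n X)).coeff (-1)
      + (killing n ⁅Z, X⁆ (loopDeriv n Y)).coeff (-1) = 0 := by
  have ht : ∀ A B : Loop n, (⁅A, B⁆ : Loop n).trace = 0 := by
    intro A B
    rw [Ring.lie_def, Matrix.trace_sub, Matrix.trace_mul_comm, sub_self]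
  have h : killing n ⁅X, Y⁆ (loopDeriv n Z) + killing n ⁅Y, Z⁆ (loopDeriv n X)
      + killing n ⁅Z, X⁆ (loopDeriv n Y)
      = LaurentSeries.derivative ℂ ((2 * n) • ((X * Y * Z).trace - (Y * X * Z).trace)) := by
    have hn : ∀ a : LaurentSeries ℂ, (2 * n) • a = 2 * (n : LaurentSeries ℂ) * a := by
      intro a; simp
    rw [map_nsmul, hn, map_sub, ← trace_loopDeriv, ← trace_loopDeriv]
    have c1 : ∀ A B C : Loop n, (A * B * C).trace = (B * C * A).trace := by
      intro A B C
      rw [mul_assoc, Matrix.trace_mul_comm]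
    have c2 : ∀ A B C : Loop n, killing n ⁅A, B⁆ C
        = 2 * (n : LaurentSeries ℂ) * ((A * B * C).trace - (B * A * C).trace) := by
      intro A B C
      simp only [killing, Ring.lie_def, sub_mul, Matrix.trace_sub]
      rw [Matrix.trace_mul_comm A B]
      ring
    simp only [c2, loopDeriv_mul, add_mul, Matrix.trace_add]
    linear_combination 2 * (n : LaurentSeries ℂ) * (-c1 (loopDeriv n X) Y Z
      + c1 Z X (loopDeriv n Y) + c1 Y (loopDeriv n X) Z + c1 (loopDeriv n X) Z Y
      + c1 (loopDeriv n Y) X Z)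
  have h3 := congrArg (fun f => HahnSeries.coeff f (-1)) h
  simpa only [residue_derivative, HahnSeries.coeff_add] using h3


/-- The two-cocycle of the central extension at level `κ = c` times the Killing form. -/
def affineCocycle (n : ℕ) (c : ℂ) :
    twoCocycle ℂ (Loop n) (TrivialLieModule ℂ (Loop n) ℂ) where
  val := ⟨(affineCochainAux n c).compr₂ (TrivialLieModule.equiv ℂ (Loop n) ℂ).symm.toLinearMap, by
    rw [mem_twoCochain_iff]
    intro X
    simp [affineCochainAux, killing_self]⟩
  property := by
    rw [mem_twoCocycle_iff_of_trivial]
    intro X Y Z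
    have h := killing_jacobi X Y Z
    change -(c * (killing n X (loopDeriv n ⁅Y, Z⁆)).coeff (-1))
      = -(c * (killing n ⁅X, Y⁆ (loopDeriv n Z)).coeff (-1))
        + -(c * (killing n Y (loopDeriv n ⁅X, Z⁆)).coeff (-1))
    have e : killing n ⁅Z, X⁆ (loopDeriv n Y) = -killing n ⁅X, Z⁆ (loopDeriv n Y) := by
      have e2 : ⁅Z, X⁆ = (-1 : ℂ) • ⁅X, Z⁆ := by
        rw [neg_one_smul, lie_skew]
      rw [e2, killing_smul_left]
      ext k
      simp
    rw [e, HahnSeries.coeff_neg] at h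
    rw [killing_skew X, killing_skew Y]
    linear_combination c * h

/-- The affine Kac-Moody algebra of `gl_n` at level `κ = c` times the Killing form
(the critical level is `c = -1/2`): the central extension of `gl_n((t))` by `ℂ` defined by
`affineCocycle n c`. -/
abbrev Affine (n : ℕ) (c : ℂ) : Type := LieAlgebra.ofTwoCocycle (affineCocycle n c)

/-- The central element `𝟏`. -/
def central (n : ℕ) (c : ℂ) : Affine n c :=
  LieAlgebra.ofProd (affineCocycle n c) (0, (TrivialLieModule.equiv ℂ (Loop n) ℂ).symm 1)

/-- The linear splitting `X ↦ (X, 0)` of the central extension. -/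
def ofLoop (n : ℕ) (c : ℂ) : Loop n →ₗ[ℂ] Affine n c where
  toFun X := LieAlgebra.ofProd (affineCocycle n c) (X, 0)
  map_add' X Y := by rw [← LieAlgebra.of_add]; simp
  map_smul' a X := by rw [RingHom.id_apply, ← LieAlgebra.of_smul]; simp

theorem lie_ofLoop {n : ℕ} {c : ℂ} (X Y : Loop n) : ⁅ofLoop n c X, ofLoop n c Y⁆
    = ofLoop n c ⁅X, Y⁆ - (c * (killing n X (loopDeriv n Y)).coeff (-1)) • central n c := by
  rw [LieAlgebra.bracket_ofTwoCocycle]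
  simp only [ofLoop, central, LinearMap.coe_mk, AddHom.coe_mk, Equiv.symm_apply_apply,
    LieModule.IsTrivial.trivial, add_zero, sub_eq_add_neg]
  rw [← neg_smul, ← LieAlgebra.of_smul, ← LieAlgebra.of_add]
  congr 1
  ext1
  · simp
  · simp only [Prod.smul_mk, Prod.mk_add_mk, zero_add, smul_zero, add_zero]
    rw [neg_zero, add_zero]
    exact (mul_one (-(c * (killing n X (loopDeriv n Y)).coeff (-1)))).symm


/-! ### Smooth modules -/

/-- `X ∈ t^N gl_n[[t]]`. -/
def VanishesBelow {n : ℕ} (N : ℤ) (X : Loop n) : Prop :=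
  ∀ i j, ∀ k < N, (X i j).coeff k = 0

theorem coeff_mul_eq_zero {f g : LaurentSeries ℂ} {a b k : ℤ} (hf : ∀ i < a, f.coeff i = 0)
    (hg : ∀ j < b, g.coeff j = 0) (hk : k < a + b) : (f * g).coeff k = 0 := by
  rw [HahnSeries.coeff_mul]
  refine Finset.sum_eq_zero fun ij hij => ?_
  have h : ij.1 + ij.2 = k := by simpa using (Finset.mem_antidiagonal.mp hij).2.2
  rcases lt_or_ge ij.1 a with h1 | h1
  · rw [hf _ h1, zero_mul]
  · rw [hg _ (by omega), mul_zero]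

theorem coeff_mul_eq_zero' {f g : LaurentSeries ℂ} {a b k : ℤ} (hf : ∀ i > a, f.coeff i = 0)
    (hg : ∀ j > b, g.coeff j = 0) (hk : k > a + b) : (f * g).coeff k = 0 := by
  rw [HahnSeries.coeff_mul]
  refine Finset.sum_eq_zero fun ij hij => ?_
  have h : ij.1 + ij.2 = k := by simpa using (Finset.mem_antidiagonal.mp hij).2.2
  rcases lt_or_ge a ij.1 with h1 | h1
  · rw [hf _ h1, zero_mul]
  · rw [hg _ (by omega), mul_zero]

theorem VanishesBelow.mono {n : ℕ} {N N' : ℤ} {X : Loop n} (h : VanishesBelow N X)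
    (hN : N' ≤ N) : VanishesBelow N' X := fun i j k hk => h i j k (by omega)

theorem VanishesBelow.mul {n : ℕ} {a b : ℤ} {X Y : Loop n} (hX : VanishesBelow a X)
    (hY : VanishesBelow b Y) : VanishesBelow (a + b) (X * Y) := by
  intro i j k hk
  rw [Matrix.mul_apply, HahnSeries.coeff_sum]
  exact Finset.sum_eq_zero fun l _ => coeff_mul_eq_zero (hX i l) (hY l j) hk

theorem VanishesBelow.lie {n : ℕ} {a b : ℤ} {X Y : Loop n} (hX : VanishesBelow a X)
    (hY : VanishesBelow b Y) : VanishesBelow (a + b) ⁅X, Y⁆ := by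
  intro i j k hk
  rw [Ring.lie_def, Matrix.sub_apply, HahnSeries.coeff_sub, hX.mul hY i j k hk,
    hY.mul hX i j k (by omega), sub_zero]

theorem VanishesBelow.loopDeriv {n : ℕ} {a : ℤ} {X : Loop n} (hX : VanishesBelow a X) :
    VanishesBelow (a - 1) (loopDeriv n X) := by
  intro i j k hk
  simp [AffineGL.loopDeriv, LaurentSeries.hasseDeriv_coeff, hX i j (k + 1) (by omega)]

theorem exists_vanishesBelow {n : ℕ} (X : Loop n) : ∃ D : ℕ, VanishesBelow (-(D : ℤ)) X := by
  refine ⟨∑ i, ∑ j, (X i j).order.natAbs, fun i j k hk => ?_⟩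
  apply HahnSeries.coeff_eq_zero_of_lt_order
  have h1 : (X i j).order.natAbs ≤ ∑ i, ∑ j, (X i j).order.natAbs :=
    (Finset.single_le_sum (f := fun j => (X i j).order.natAbs) (fun _ _ => Nat.zero_le _)
      (Finset.mem_univ j)).trans
    (Finset.single_le_sum (f := fun i => ∑ j, (X i j).order.natAbs) (fun _ _ => Nat.zero_le _)
      (Finset.mem_univ i))
  omega

theorem killing_coeff_eq_zero_of {n : ℕ} {r : ℤ} {X Y : Loop n}
    (h : ∀ i j k l, (X i j * Y k l).coeff r = 0) : (killing n X Y).coeff r = 0 := by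
  have e : killing n X Y = (2 * n) • (X * Y).trace - 2 • (X.trace * Y.trace) := by
    simp [killing, mul_assoc]
  rw [e, HahnSeries.coeff_sub, HahnSeries.coeff_nsmul, HahnSeries.coeff_nsmul, Pi.smul_apply,
    Pi.smul_apply, Matrix.trace, Matrix.trace, Matrix.trace, Finset.sum_mul_sum]
  simp only [Matrix.diag_apply, Matrix.mul_apply, HahnSeries.coeff_sum, h, Finset.sum_const_zero,
    smul_zero, sub_zero]

theorem killing_coeff_eq_zero {n : ℕ} {a b k : ℤ} {X Y : Loop n} (hX : VanishesBelow a X)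
    (hY : VanishesBelow b Y) (hk : k < a + b) : (killing n X Y).coeff k = 0 :=
  killing_coeff_eq_zero_of fun i j p q => coeff_mul_eq_zero (hX i j) (hY p q) hk

variable (n : ℕ) (c : ℂ) (M : Type*) [AddCommGroup M] [Module ℂ M]
  [LieRingModule (Affine n c) M] [LieModule ℂ (Affine n c) M]

/-- `v` is annihilated by `t^N gl_n[[t]]` for some `N`. -/
def IsSmoothVector {n : ℕ} {c : ℂ} {M : Type*} [AddCommGroup M] [LieRingModule (Affine n c) M]
    (v : M) : Prop :=
  ∃ N : ℕ, ∀ X : Loop n, VanishesBelow N X → ⁅ofLoop n c X, v⁆ = 0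

/-- The submodule of all smooth vectors; this is the largest smooth submodule of `M`, and it is
all of `M` when `M` is smooth. -/
def smoothPart : LieSubmodule ℂ (Affine n c) M where
  carrier := {v | IsSmoothVector (n := n) (c := c) v}
  zero_mem' := ⟨0, fun X _ => lie_zero _⟩
  add_mem' := by
    rintro v w ⟨N, hN⟩ ⟨N', hN'⟩
    refine ⟨N + N', fun X hX => ?_⟩
    rw [lie_add, hN X (hX.mono (by push_cast; omega)), hN' X (hX.mono (by push_cast; omega)),
      add_zero]
  smul_mem' := by
    rintro a v ⟨N, hN⟩
    exact ⟨N, fun X hX => by rw [lie_smul, hN X hX, smul_zero]⟩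
  lie_mem := by
    rintro ⟨Z, z⟩ v ⟨N, hN⟩
    obtain ⟨D, hD⟩ := exists_vanishesBelow Z
    refine ⟨N + D + 1, fun X hX => ?_⟩
    have hZ : (⟨(Z, z)⟩ : Affine n c)
        = ofLoop n c Z + (TrivialLieModule.equiv ℂ (Loop n) ℂ z) • central n c := by
      simp only [ofLoop, central, LinearMap.coe_mk, AddHom.coe_mk]
      rw [← LieAlgebra.of_smul, ← LieAlgebra.of_add, Prod.smul_mk, Prod.mk_add_mk, ← map_smul,
        smul_eq_mul, mul_one, smul_zero, add_zero, zero_add, LinearEquiv.symm_apply_apply]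
      rfl
    have hc : ⁅ofLoop n c X, central n c⁆ = 0 := by
      rw [LieAlgebra.bracket_ofTwoCocycle]
      simp only [ofLoop, central, LinearMap.coe_mk, AddHom.coe_mk, Equiv.symm_apply_apply, lie_zero,
        map_zero, LieModule.IsTrivial.trivial, add_zero, sub_zero]
      rfl
    have h1 : ⁅ofLoop n c X, (⟨(Z, z)⟩ : Affine n c)⁆ = ofLoop n c ⁅X, Z⁆ := by
      rw [hZ, lie_add, lie_smul, hc, lie_ofLoop,
        killing_coeff_eq_zero hX hD.loopDeriv (by push_cast; omega)]
      simp
    rw [leibniz_lie, h1, hN _ ((hX.lie hD).mono (by push_cast; omega)),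
      hN X (hX.mono (by push_cast; omega))]
    simp

/-- A module is smooth if every vector of it is annihilated by `t^N gl_n[[t]]` for some `N`. -/
class IsSmooth : Prop where
  isSmoothVector : ∀ v : M, IsSmoothVector (n := n) (c := c) v

instance : IsSmooth n c (smoothPart n c M) where
  isSmoothVector v := by
    obtain ⟨N, hN⟩ := v.2
    exact ⟨N, fun X hX => Subtype.ext (hN X hX)⟩


/-! ### The Lie algebra `t⁻¹ gl_n[t⁻¹]` and expansions of `f(t - w)` -/

/-- `gl_n[t⁻¹]`. Throughout, the polynomial variable `X` of `ℂ[X]` stands for `t⁻¹`. -/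
abbrev PolyLoop (n : ℕ) : Type := Matrix (Fin n) (Fin n) ℂ[X]

instance (n : ℕ) : LieRing (PolyLoop n) := LieRing.ofAssociativeRing

instance (n : ℕ) : LieAlgebra ℂ (PolyLoop n) := LieAlgebra.ofAssociativeAlgebra

/-- `t⁻¹ gl_n[t⁻¹]`: matrices of polynomials in `X = t⁻¹` without constant term. -/
def gMinus (n : ℕ) : LieSubalgebra ℂ (PolyLoop n) where
  carrier := {A | ∀ i j, (A i j).coeff 0 = 0}
  zero_mem' := fun i j => by simp
  add_mem' := fun hA hB i j => by simp [hA i j, hB i j]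
  smul_mem' := fun a A hA i j => by simp [hA i j]
  lie_mem' := fun {A B} hA hB i j => by
    simp only [Set.mem_ofPred_eq] at hA hB
    simp [Ring.lie_def, Matrix.mul_apply, Polynomial.finsetSum_coeff, Polynomial.mul_coeff_zero, hA, hB]

/-- The expansion of `f(t - w)` in nonnegative powers of `w` (the region `|t| > |w|`), a power
series in `w` over `ℂ((t))`; it sends `t⁻¹` to `(t - w)⁻¹ = ∑_{j ≥ 0} t^(-1-j) w^j`. -/
def taylorPlus : ℂ[X] →+* PowerSeries (LaurentSeries ℂ) :=
  Polynomial.eval₂RingHom (PowerSeries.C.comp HahnSeries.C)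
    (PowerSeries.mk fun j => HahnSeries.single (-1 - (j : ℤ)) 1)

/-- The expansion of `f(t - w)` in nonnegative powers of `t` (the region `|t| < |w|`), a power
series in `w⁻¹` over `ℂ((t))`; it sends `t⁻¹` to `(t - w)⁻¹ = - ∑_{p ≥ 1} t^(p-1) w^(-p)`. -/
def taylorMinus : ℂ[X] →+* PowerSeries (LaurentSeries ℂ) :=
  Polynomial.eval₂RingHom (PowerSeries.C.comp HahnSeries.C)
    (PowerSeries.mk fun p => if p = 0 then 0 else -HahnSeries.single ((p : ℤ) - 1) 1)

/-- The `j`-th coefficient of an expansion, applied entrywise. -/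
def expand {n : ℕ} (φ : ℂ[X] →+* PowerSeries (LaurentSeries ℂ)) (j : ℕ) (A : PolyLoop n) : Loop n :=
  A.map fun f => PowerSeries.coeff j (φ f)

theorem expand_add {n : ℕ} (φ : ℂ[X] →+* PowerSeries (LaurentSeries ℂ)) (j : ℕ)
    (A B : PolyLoop n) : expand φ j (A + B) = expand φ j A + expand φ j B := by
  ext1 a b
  simp [expand]

theorem expand_smul {n : ℕ} {φ : ℂ[X] →+* PowerSeries (LaurentSeries ℂ)}
    (hφ : ∀ a, φ (Polynomial.C a) = PowerSeries.C (HahnSeries.C a)) (j : ℕ) (a : ℂ)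
    (A : PolyLoop n) : expand φ j (a • A) = a • expand φ j A := by
  ext1 i k
  simp only [expand, Matrix.map_apply, Matrix.smul_apply, Polynomial.smul_eq_C_mul, map_mul, hφ,
    PowerSeries.coeff_C_mul]
  exact HahnSeries.C_mul_eq_smul

theorem expand_mul {n : ℕ} (φ : ℂ[X] →+* PowerSeries (LaurentSeries ℂ)) (k : ℕ)
    (A B : PolyLoop n) : expand φ k (A * B)
      = ∑ p ∈ Finset.HasAntidiagonal.antidiagonal k, expand φ p.1 A * expand φ p.2 B := by
  ext1 i j
  simp only [expand, Matrix.map_apply, Matrix.mul_apply, map_sum, map_mul, PowerSeries.coeff_mul,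
    Matrix.sum_apply]
  rw [Finset.sum_comm]

theorem expand_lie {n : ℕ} (φ : ℂ[X] →+* PowerSeries (LaurentSeries ℂ)) (k : ℕ)
    (A B : PolyLoop n) : expand φ k ⁅A, B⁆
      = ∑ p ∈ Finset.HasAntidiagonal.antidiagonal k, ⁅expand φ p.1 A, expand φ p.2 B⁆ := by
  have hs : ∀ A B : PolyLoop n, expand φ k (A - B) = expand φ k A - expand φ k B := by
    intro A B
    ext1 a b
    simp [expand]
  simp only [Ring.lie_def, hs, expand_mul, Finset.sum_sub_distrib]
  congr 1
  exact (Finset.sum_equiv (Equiv.prodComm ℕ ℕ) (by simp [add_comm]) (by simp))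

theorem taylorPlus_coeff (f : ℂ[X]) (j : ℕ) (k : ℤ) (hk : 0 < k) :
    (PowerSeries.coeff j (taylorPlus f)).coeff k = 0 := by
  have hmul : ∀ P Q : PowerSeries (LaurentSeries ℂ),
      (∀ j, ∀ k : ℤ, k > 0 → (PowerSeries.coeff j P).coeff k = 0) →
      (∀ j, ∀ k : ℤ, k > 0 → (PowerSeries.coeff j Q).coeff k = 0) →
      (∀ j, ∀ k : ℤ, k > 0 → (PowerSeries.coeff j (P * Q)).coeff k = 0) := by
    intro P Q hP hQ j k hk
    rw [PowerSeries.coeff_mul, HahnSeries.coeff_sum]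
    exact Finset.sum_eq_zero fun p _ => coeff_mul_eq_zero' (hP _) (hQ _) (by omega)
  have hX : ∀ j, ∀ k : ℤ, k > 0 → (PowerSeries.coeff j (taylorPlus Polynomial.X)).coeff k = 0 := by
    intro j k hk
    simp only [taylorPlus, Polynomial.coe_eval₂RingHom, Polynomial.eval₂_X, PowerSeries.coeff_mk]
    exact HahnSeries.coeff_single_of_ne (by omega)
  suffices h : ∀ j, ∀ k : ℤ, k > 0 → (PowerSeries.coeff j (taylorPlus f)).coeff k = 0 from h j k hk
  induction f using Polynomial.induction_on with
  | C a =>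
    intro j k hk
    simp only [taylorPlus, Polynomial.coe_eval₂RingHom, Polynomial.eval₂_C, RingHom.comp_apply,
      PowerSeries.coeff_C]
    split_ifs
    · exact HahnSeries.coeff_single_of_ne (by omega)
    · simp
  | add p q hp hq =>
    intro j k hk
    rw [map_add, map_add, HahnSeries.coeff_add, hp j k hk, hq j k hk, add_zero]
  | monomial m a h =>
    rw [pow_succ, ← mul_assoc, map_mul]
    exact hmul _ _ h hX


theorem taylorMinus_X_coeff (p : ℕ) (k : ℤ) (hk : k < (p : ℤ) - 1 ∨ k < 0) :
    (PowerSeries.coeff p (taylorMinus Polynomial.X)).coeff k = 0 := by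
  simp only [taylorMinus, Polynomial.coe_eval₂RingHom, Polynomial.eval₂_X, PowerSeries.coeff_mk]
  split_ifs with h
  · simp
  · rw [HahnSeries.coeff_neg, neg_eq_zero]
    exact HahnSeries.coeff_single_of_ne (by omega)

theorem taylorMinus_C_coeff (a : ℂ) (p : ℕ) (k : ℤ) (hk : k < (p : ℤ) ∨ k < 0) :
    (PowerSeries.coeff p (taylorMinus (Polynomial.C a))).coeff k = 0 := by
  simp only [taylorMinus, Polynomial.coe_eval₂RingHom, Polynomial.eval₂_C, RingHom.comp_apply,
      PowerSeries.coeff_C]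
  split_ifs with h
  · subst h
    exact HahnSeries.coeff_single_of_ne (by push_cast at hk; omega)
  · simp

theorem taylorMinus_coeff (f : ℂ[X]) : ∃ u : ℕ, ∀ (p : ℕ) (k : ℤ), k < (p : ℤ) - u →
    (PowerSeries.coeff p (taylorMinus f)).coeff k = 0 := by
  induction f using Polynomial.induction_on with
  | C a => exact ⟨0, fun p k hk => taylorMinus_C_coeff a p k (by push_cast at hk; omega)⟩
  | add f g hf hg =>
    obtain ⟨u, hu⟩ := hf
    obtain ⟨w, hw⟩ := hg
    refine ⟨u + w, fun p k hk => ?_⟩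
    push_cast at hk
    rw [map_add, map_add, HahnSeries.coeff_add, hu p k (by omega), hw p k (by omega), add_zero]
  | monomial m a h =>
    obtain ⟨u, hu⟩ := h
    refine ⟨u + 1, fun p k hk => ?_⟩
    push_cast at hk
    rw [pow_succ, ← mul_assoc, map_mul, PowerSeries.coeff_mul, HahnSeries.coeff_sum]
    refine Finset.sum_eq_zero fun q hq => ?_
    rw [Finset.HasAntidiagonal.mem_antidiagonal] at hq
    exact coeff_mul_eq_zero (hu q.1) (fun j hj => taylorMinus_X_coeff q.2 j (Or.inl hj))
      (by omega)

theorem taylorMinus_coeff_neg (f : ℂ[X]) (p : ℕ) (k : ℤ) (hk : k < 0) :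
    (PowerSeries.coeff p (taylorMinus f)).coeff k = 0 := by
  induction f using Polynomial.induction_on generalizing p k with
  | C a => exact taylorMinus_C_coeff a p k (Or.inr hk)
  | add f g hf hg => rw [map_add, map_add, HahnSeries.coeff_add, hf p k hk, hg p k hk, add_zero]
  | monomial m a h =>
    rw [pow_succ, ← mul_assoc, map_mul, PowerSeries.coeff_mul, HahnSeries.coeff_sum]
    exact Finset.sum_eq_zero fun q _ => coeff_mul_eq_zero (fun i hi => h q.1 i hi)
      (fun j hj => taylorMinus_X_coeff q.2 j (Or.inr hj)) (by omega)

theorem exists_expand_taylorMinus_vanishes {n : ℕ} (A : PolyLoop n) :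
    ∃ u : ℕ, ∀ p : ℕ, VanishesBelow ((p : ℤ) - u) (expand taylorMinus p A) := by
  choose u hu using fun i j => taylorMinus_coeff (A i j)
  refine ⟨∑ i, ∑ j, u i j, fun p i j k hk => hu i j p k ?_⟩
  have h1 : u i j ≤ ∑ i, ∑ j, u i j :=
    (Finset.single_le_sum (f := fun j => u i j) (fun _ _ => Nat.zero_le _)
      (Finset.mem_univ j)).trans
    (Finset.single_le_sum (f := fun i => ∑ j, u i j) (fun _ _ => Nat.zero_le _)
      (Finset.mem_univ i))
  have h2 : (u i j : ℤ) ≤ ((∑ i, ∑ j, u i j : ℕ) : ℤ) := by exact_mod_cast h1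
  omega

theorem expand_lie_ofLoop_minus {n : ℕ} {c : ℂ} (A B : PolyLoop n) (p q : ℕ) :
    ⁅ofLoop n c (expand taylorMinus p A), ofLoop n c (expand taylorMinus q B)⁆
      = ofLoop n c ⁅expand taylorMinus p A, expand taylorMinus q B⁆ := by
  have hv : ∀ (A : PolyLoop n) (p : ℕ), VanishesBelow 0 (expand taylorMinus p A) :=
    fun A p i j k hk => taylorMinus_coeff_neg (A i j) p k hk
  have hd : VanishesBelow 0 (loopDeriv n (expand taylorMinus q B)) := by
    intro i j k hk
    simp only [loopDeriv, LinearMap.mapMatrix_apply, Matrix.map_apply,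
      LaurentSeries.derivative_apply, LaurentSeries.hasseDeriv_coeff]
    rcases eq_or_ne k (-1) with rfl | h
    · simp
    · rw [hv B q i j _ (by push_cast; omega), smul_zero]
  rw [lie_ofLoop, killing_coeff_eq_zero (hv A p) hd (by norm_num)]
  simp

theorem expand_lie_ofLoop_plus {n : ℕ} {c : ℂ} (A B : PolyLoop n) (p q : ℕ) :
    ⁅ofLoop n c (expand taylorPlus p A), ofLoop n c (expand taylorPlus q B)⁆
      = ofLoop n c ⁅expand taylorPlus p A, expand taylorPlus q B⁆ := by
  have hv : ∀ (A : PolyLoop n) (p : ℕ) i j, ∀ k : ℤ, k > 0 → (expand taylorPlus p A i j).coeff k = 0 :=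
    fun A p i j k hk => taylorPlus_coeff (A i j) p k hk
  have hd : ∀ i j, ∀ k : ℤ, k > -2 → (loopDeriv n (expand taylorPlus q B) i j).coeff k = 0 := by
    intro i j k hk
    simp only [loopDeriv, LinearMap.mapMatrix_apply, Matrix.map_apply,
      LaurentSeries.derivative_apply, LaurentSeries.hasseDeriv_coeff]
    rcases eq_or_ne k (-1) with rfl | h
    · simp
    · rw [hv B q i j _ (by push_cast; omega), smul_zero]
  have hk : (killing n (expand taylorPlus p A) (loopDeriv n (expand taylorPlus q B))).coeff (-1)
      = 0 :=
    killing_coeff_eq_zero_of fun i j k l => coeff_mul_eq_zero' (hv A p i j) (hd k l) (by norm_num)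
  rw [lie_ofLoop, hk]
  simp

variable {n c M}


/-! ### Fields on a smooth module

A field `F(w) = ∑ F_(s) w^(-s-1)` is a `VertexOperator ℂ M`, and `ncoeff F s` is `F_(s)`. -/

open VertexOperator (ncoeff)

theorem vertex_ext {F G : VertexOperator ℂ M} (h : ∀ s v, ncoeff F s v = ncoeff G s v) :
    F = G := by
  apply HVertexOperator.coeff_inj
  funext k
  rw [VertexOperator.coeff_eq_ncoeff, VertexOperator.coeff_eq_ncoeff]
  exact LinearMap.ext (h _)

theorem exists_ncoeff_eq_zero (F : VertexOperator ℂ M) (v : M) :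
    ∃ S : ℤ, ∀ s ≥ S, ncoeff F s v = 0 :=
  ⟨-HahnSeries.order ((HahnModule.of ℂ).symm (F v)), fun s hs =>
    VertexOperator.ncoeff_eq_zero_of_lt_order F s v (by omega)⟩

theorem exists_ncoeff_eq_zero_range (F : VertexOperator ℂ M) (w : ℕ → M) (N : ℕ) :
    ∃ S : ℤ, ∀ p < N, ∀ s ≥ S, ncoeff F s (w p) = 0 := by
  choose S hS using fun p => exists_ncoeff_eq_zero F (w p)
  refine ⟨∑ p ∈ Finset.range N, |S p|, fun p hp s hs => hS p s ?_⟩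
  have h1 := Finset.single_le_sum (f := fun p => |S p|) (fun _ _ => abs_nonneg _)
    (Finset.mem_range.mpr hp)
  have h2 := le_abs_self (S p)
  exact (h2.trans h1).trans hs

theorem exists_minus_eq_zero [IsSmooth n c M] (A : PolyLoop n) (v : M) :
    ∃ N : ℕ, ∀ p ≥ N, ⁅ofLoop n c (expand taylorMinus p A), v⁆ = 0 := by
  obtain ⟨K, hK⟩ := IsSmooth.isSmoothVector (n := n) (c := c) v
  obtain ⟨u, hu⟩ := exists_expand_taylorMinus_vanishes A
  exact ⟨K + u, fun p hp => hK _ ((hu p).mono (by omega))⟩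

theorem finsum_eq_sum_range {f : ℕ → M} {N : ℕ} (h : ∀ j ≥ N, f j = 0) :
    ∑ᶠ j, f j = ∑ j ∈ Finset.range N, f j := by
  refine finsum_eq_sum_of_support_subset _ fun j hj => ?_
  by_contra hj'
  exact hj (h j (by simpa using hj'))

/-- The coefficient of `w^(-s-1)` in `A(t - w) F(w)`, with `A(t - w)` expanded in `|t| > |w|`. -/
def leftMode (c : ℂ) [LieRingModule (Affine n c) M] [LieModule ℂ (Affine n c) M]
    (A : PolyLoop n) (F : VertexOperator ℂ M) (s : ℤ) : Module.End ℂ M where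
  toFun v := ∑ᶠ j : ℕ, ⁅ofLoop n c (expand taylorPlus j A), ncoeff F (s + j) v⁆
  map_add' v w := by
    obtain ⟨S, hS⟩ := exists_ncoeff_eq_zero F v
    obtain ⟨S', hS'⟩ := exists_ncoeff_eq_zero F w
    rw [finsum_eq_sum_range (N := (S - s).toNat + (S' - s).toNat),
      finsum_eq_sum_range (N := (S - s).toNat + (S' - s).toNat),
      finsum_eq_sum_range (N := (S - s).toNat + (S' - s).toNat), ← Finset.sum_add_distrib]
    · simp only [map_add, lie_add]
    · intro j hj
      rw [hS' _ (by omega), lie_zero]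
    · intro j hj
      rw [hS _ (by omega), lie_zero]
    · intro j hj
      rw [map_add, hS _ (by omega), hS' _ (by omega), add_zero, lie_zero]
  map_smul' a v := by
    obtain ⟨S, hS⟩ := exists_ncoeff_eq_zero F v
    rw [finsum_eq_sum_range (N := (S - s).toNat), finsum_eq_sum_range (N := (S - s).toNat),
      RingHom.id_apply, Finset.smul_sum]
    · simp only [map_smul, lie_smul]
    · intro j hj
      rw [hS _ (by omega), lie_zero]
    · intro j hj
      rw [map_smul, hS _ (by omega), smul_zero, lie_zero]

theorem leftMode_apply (A : PolyLoop n) (F : VertexOperator ℂ M) (s : ℤ) (v : M) (N : ℕ)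
    (h : ∀ j ≥ N, ncoeff F (s + j) v = 0) : leftMode c A F s v
      = ∑ j ∈ Finset.range N, ⁅ofLoop n c (expand taylorPlus j A), ncoeff F (s + j) v⁆ :=
  finsum_eq_sum_range fun j hj => by rw [h j hj, lie_zero]

/-- The coefficient of `w^(-s-1)` in `F(w) A(t - w)`, with `A(t - w)` expanded in `|t| < |w|`. -/
def rightMode (c : ℂ) [LieRingModule (Affine n c) M] [LieModule ℂ (Affine n c) M]
    [IsSmooth n c M] (A : PolyLoop n) (F : VertexOperator ℂ M) (s : ℤ) : Module.End ℂ M where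
  toFun v := ∑ᶠ p : ℕ, ncoeff F (s - p) ⁅ofLoop n c (expand taylorMinus p A), v⁆
  map_add' v w := by
    obtain ⟨S, hS⟩ := exists_minus_eq_zero (c := c) A v
    obtain ⟨S', hS'⟩ := exists_minus_eq_zero (c := c) A w
    rw [finsum_eq_sum_range (N := S + S'), finsum_eq_sum_range (N := S + S'),
      finsum_eq_sum_range (N := S + S'), ← Finset.sum_add_distrib]
    · simp only [map_add, lie_add]
    · intro j hj
      rw [hS' _ (by omega), map_zero]
    · intro j hj
      rw [hS _ (by omega), map_zero]
    · intro j hj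
      rw [lie_add, hS _ (by omega), hS' _ (by omega), add_zero, map_zero]
  map_smul' a v := by
    obtain ⟨S, hS⟩ := exists_minus_eq_zero (c := c) A v
    rw [finsum_eq_sum_range (N := S), finsum_eq_sum_range (N := S),
      RingHom.id_apply, Finset.smul_sum]
    · simp only [map_smul, lie_smul]
    · intro j hj
      rw [hS _ (by omega), map_zero]
    · intro j hj
      rw [lie_smul, hS _ (by omega), smul_zero, map_zero]

theorem rightMode_apply [IsSmooth n c M] (A : PolyLoop n) (F : VertexOperator ℂ M) (s : ℤ)
    (v : M) (N : ℕ) (h : ∀ p ≥ N, ⁅ofLoop n c (expand taylorMinus p A), v⁆ = 0) :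
    rightMode c A F s v
      = ∑ p ∈ Finset.range N, ncoeff F (s - p) ⁅ofLoop n c (expand taylorMinus p A), v⁆ :=
  finsum_eq_sum_range fun j hj => by rw [h j hj, map_zero]

theorem bddBelow_support {f : ℤ → Module.End ℂ M} {v : M} {S : ℤ} (h : ∀ s ≥ S, f s v = 0) :
    BddBelow (Function.support fun k => f (-k - 1) v) := by
  refine ⟨-S, fun k hk => ?_⟩
  by_contra hk'
  exact hk (h _ (by omega))

theorem exists_leftMode_eq_zero (A : PolyLoop n) (F : VertexOperator ℂ M) (v : M) :
    ∃ S : ℤ, ∀ s ≥ S, leftMode c A F s v = 0 := by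
  obtain ⟨S, hS⟩ := exists_ncoeff_eq_zero F v
  refine ⟨S, fun s hs => ?_⟩
  rw [leftMode_apply A F s v 0 fun j _ => hS _ (by omega), Finset.range_zero, Finset.sum_empty]

theorem exists_rightMode_eq_zero [IsSmooth n c M] (A : PolyLoop n) (F : VertexOperator ℂ M)
    (v : M) : ∃ S : ℤ, ∀ s ≥ S, rightMode c A F s v = 0 := by
  obtain ⟨N, hN⟩ := exists_minus_eq_zero (c := c) A v
  obtain ⟨S, hS⟩ := exists_ncoeff_eq_zero_range F
    (fun p => ⁅ofLoop n c (expand taylorMinus p A), v⁆) N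
  refine ⟨S + N, fun s hs => ?_⟩
  rw [rightMode_apply A F s v N hN]
  refine Finset.sum_eq_zero fun p hp => ?_
  rw [Finset.mem_range] at hp
  exact hS p hp _ (by omega)

/-- The field attached to `A · b` when `F` is the field attached to the state `b` of the affine
vertex algebra. For `A = x ⊗ t^(-k-1)` it is the normally ordered product
`(1/k!) :∂^k x(w) F(w):`, that is, the coefficient of `w^(-s-1)` is
`∑_{j ≥ 0} (-1)^j binom(-k-1, j) (x[-k-1-j] F_(s+j) - (-1)^(-k-1) F_(s-k-1-j) x[j])`. -/
def fieldAct (c : ℂ) [LieRingModule (Affine n c) M] [LieModule ℂ (Affine n c) M]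
    [IsSmooth n c M] (A : PolyLoop n) (F : VertexOperator ℂ M) : VertexOperator ℂ M :=
  VertexOperator.of_coeff (fun k => leftMode c A F (-k - 1) - rightMode c A F (-k - 1)) fun v => by
    obtain ⟨S, hS⟩ := exists_leftMode_eq_zero (c := c) A F v
    obtain ⟨S', hS'⟩ := exists_rightMode_eq_zero (c := c) A F v
    refine bddBelow_support (f := fun s => leftMode c A F s - rightMode c A F s)
      (S := max S S') fun s hs => ?_
    rw [LinearMap.sub_apply, hS s (by omega), hS' s (by omega), sub_zero]

theorem ncoeff_fieldAct [IsSmooth n c M] (A : PolyLoop n) (F : VertexOperator ℂ M) (s : ℤ) :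
    ncoeff (fieldAct c A F) s = leftMode c A F s - rightMode c A F s := by
  rw [fieldAct, VertexOperator.ncoeff_of_coeff]
  ring_nf


open Filter in
theorem eventually_fieldAct [IsSmooth n c M] (A : PolyLoop n) (F : VertexOperator ℂ M) (s : ℤ)
    (v : M) : ∀ᶠ N : ℕ in atTop, ncoeff (fieldAct c A F) s v
      = ∑ j ∈ Finset.range N, ⁅ofLoop n c (expand taylorPlus j A), ncoeff F (s + j) v⁆
        - ∑ p ∈ Finset.range N, ncoeff F (s - p) ⁅ofLoop n c (expand taylorMinus p A), v⁆ := by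
  obtain ⟨S, hS⟩ := exists_ncoeff_eq_zero F v
  obtain ⟨P, hP⟩ := exists_minus_eq_zero (c := c) A v
  filter_upwards [eventually_ge_atTop ((S - s).toNat + P)] with N hN
  rw [ncoeff_fieldAct, LinearMap.sub_apply, leftMode_apply A F s v N fun j hj => hS _ (by omega),
    rightMode_apply A F s v N fun p hp => hP p (by omega)]

theorem fieldAct_add [IsSmooth n c M] (A : PolyLoop n) (F G : VertexOperator ℂ M) :
    fieldAct c A (F + G) = fieldAct c A F + fieldAct c A G := by
  refine vertex_ext fun s v => ?_
  obtain ⟨N, h1, h2, h3⟩ := ((eventually_fieldAct (c := c) A (F + G) s v).and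
    ((eventually_fieldAct (c := c) A F s v).and (eventually_fieldAct (c := c) A G s v))).exists
  rw [map_add, Pi.add_apply, LinearMap.add_apply, h1, h2, h3]
  simp only [map_add, Pi.add_apply, LinearMap.add_apply, lie_add, Finset.sum_add_distrib]
  abel

theorem fieldAct_smul [IsSmooth n c M] (A : PolyLoop n) (a : ℂ) (F : VertexOperator ℂ M) :
    fieldAct c A (a • F) = a • fieldAct c A F := by
  refine vertex_ext fun s v => ?_
  obtain ⟨N, h1, h2⟩ := ((eventually_fieldAct (c := c) A (a • F) s v).and
    (eventually_fieldAct (c := c) A F s v)).exists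
  rw [map_smul, Pi.smul_apply, LinearMap.smul_apply, h1, h2]
  simp only [map_smul, Pi.smul_apply, LinearMap.smul_apply, lie_smul, smul_sub, Finset.smul_sum]

theorem add_fieldAct [IsSmooth n c M] (A B : PolyLoop n) (F : VertexOperator ℂ M) :
    fieldAct c (A + B) F = fieldAct c A F + fieldAct c B F := by
  refine vertex_ext fun s v => ?_
  obtain ⟨N, h1, h2, h3⟩ := ((eventually_fieldAct (c := c) (A + B) F s v).and
    ((eventually_fieldAct (c := c) A F s v).and (eventually_fieldAct (c := c) B F s v))).exists
  rw [map_add, Pi.add_apply, LinearMap.add_apply, h1, h2, h3]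
  simp only [expand_add, map_add, add_lie, Finset.sum_add_distrib]
  abel

theorem smul_fieldAct [IsSmooth n c M] (a : ℂ) (A : PolyLoop n) (F : VertexOperator ℂ M) :
    fieldAct c (a • A) F = a • fieldAct c A F := by
  have hp : ∀ b, taylorPlus (Polynomial.C b) = PowerSeries.C (HahnSeries.C b) := fun b => by
    simp [taylorPlus]
  have hm : ∀ b, taylorMinus (Polynomial.C b) = PowerSeries.C (HahnSeries.C b) := fun b => by
    simp [taylorMinus]
  refine vertex_ext fun s v => ?_
  obtain ⟨N, h1, h2⟩ := ((eventually_fieldAct (c := c) (a • A) F s v).and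
    (eventually_fieldAct (c := c) A F s v)).exists
  rw [map_smul, Pi.smul_apply, LinearMap.smul_apply, h1, h2]
  simp only [expand_smul hp, expand_smul hm, map_smul, smul_lie, smul_sub, Finset.smul_sum]

open Filter in
theorem eventually_fieldAct_fieldAct [IsSmooth n c M] (A B : PolyLoop n)
    (F : VertexOperator ℂ M) (s : ℤ) (v : M) :
    ∀ᶠ N : ℕ in atTop, ncoeff (fieldAct c A (fieldAct c B F)) s v
      = (∑ k ∈ Finset.range N, ∑ ij ∈ Finset.HasAntidiagonal.antidiagonal k,
          ⁅ofLoop n c (expand taylorPlus ij.1 A),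
            ⁅ofLoop n c (expand taylorPlus ij.2 B), ncoeff F (s + k) v⁆⁆)
        - (∑ i ∈ Finset.range N, ∑ p ∈ Finset.range N, ⁅ofLoop n c (expand taylorPlus i A),
            ncoeff F (s + i - p) ⁅ofLoop n c (expand taylorMinus p B), v⁆⁆)
        - (∑ p ∈ Finset.range N, ∑ i ∈ Finset.range N, ⁅ofLoop n c (expand taylorPlus i B),
            ncoeff F (s - p + i) ⁅ofLoop n c (expand taylorMinus p A), v⁆⁆)
        + ∑ k ∈ Finset.range N, ∑ pq ∈ Finset.HasAntidiagonal.antidiagonal k,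
            ncoeff F (s - k) ⁅ofLoop n c (expand taylorMinus pq.2 B),
              ⁅ofLoop n c (expand taylorMinus pq.1 A), v⁆⁆ := by
  obtain ⟨S, hS⟩ := exists_ncoeff_eq_zero F v
  obtain ⟨P, hP⟩ := exists_minus_eq_zero (c := c) A v
  obtain ⟨Q, hQ⟩ := exists_minus_eq_zero (c := c) B v
  obtain ⟨T, hT⟩ := exists_ncoeff_eq_zero_range F
    (fun p => ⁅ofLoop n c (expand taylorMinus p A), v⁆) P
  choose R hR using fun p : ℕ =>
    exists_minus_eq_zero (c := c) B ⁅ofLoop n c (expand taylorMinus p A), v⁆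
  have hR' : ∀ p < P, R p ≤ ∑ p ∈ Finset.range P, R p := fun p hp =>
    Finset.single_le_sum (f := R) (fun _ _ => Nat.zero_le _) (Finset.mem_range.mpr hp)
  filter_upwards [eventually_fieldAct (c := c) A (fieldAct c B F) s v,
    eventually_ge_atTop ((S - s).toNat + P + Q + (T - s + P).toNat + ∑ p ∈ Finset.range P, R p)]
    with N hA hN
  have hl : ∀ i ∈ Finset.range N, ⁅ofLoop n c (expand taylorPlus i A),
      ncoeff (fieldAct c B F) (s + i) v⁆
      = (∑ j ∈ Finset.range (N - i), ⁅ofLoop n c (expand taylorPlus i A),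
          ⁅ofLoop n c (expand taylorPlus j B), ncoeff F (s + (i + j : ℕ)) v⁆⁆)
        - ∑ p ∈ Finset.range N, ⁅ofLoop n c (expand taylorPlus i A),
            ncoeff F (s + i - p) ⁅ofLoop n c (expand taylorMinus p B), v⁆⁆ := by
    intro i hi
    rw [Finset.mem_range] at hi
    rw [ncoeff_fieldAct, LinearMap.sub_apply,
      leftMode_apply B F (s + i) v (N - i) fun j hj => hS _ (by omega),
      rightMode_apply B F (s + i) v N fun p hp => hQ p (by omega), lie_sub, lie_sum, lie_sum]
    simp only [Nat.cast_add, add_assoc]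
  have hr : ∀ p ∈ Finset.range N, ncoeff (fieldAct c B F) (s - p)
      ⁅ofLoop n c (expand taylorMinus p A), v⁆
      = (∑ i ∈ Finset.range N, ⁅ofLoop n c (expand taylorPlus i B),
            ncoeff F (s - p + i) ⁅ofLoop n c (expand taylorMinus p A), v⁆⁆)
        - ∑ q ∈ Finset.range (N - p), ncoeff F (s - (p + q : ℕ))
            ⁅ofLoop n c (expand taylorMinus q B),
              ⁅ofLoop n c (expand taylorMinus p A), v⁆⁆ := by
    intro p hp
    rw [Finset.mem_range] at hp
    rw [ncoeff_fieldAct, LinearMap.sub_apply,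
      leftMode_apply B F (s - p) _ N ?_, rightMode_apply B F (s - p) _ (N - p) ?_]
    · simp only [Nat.cast_add, sub_sub]
    · intro q hq
      rcases lt_or_ge p P with h | h
      · exact hR p q (by have := hR' p h; omega)
      · rw [hP p h, lie_zero]
    · intro i hi
      rcases lt_or_ge p P with h | h
      · exact hT p h _ (by omega)
      · rw [hP p h, map_zero]
  rw [hA, Finset.sum_congr rfl hl, Finset.sum_congr rfl hr, Finset.sum_sub_distrib,
    Finset.sum_sub_distrib]
  have e1 := Finset.sum_range_diag_flip N fun i j => ⁅ofLoop n c (expand taylorPlus i A),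
          ⁅ofLoop n c (expand taylorPlus j B), ncoeff F (s + (i + j : ℕ)) v⁆⁆
  have e2 := Finset.sum_range_diag_flip N fun p q => ncoeff F (s - (p + q : ℕ))
            ⁅ofLoop n c (expand taylorMinus q B),
              ⁅ofLoop n c (expand taylorMinus p A), v⁆⁆
  have f1 : ∑ k ∈ Finset.range N, ∑ ij ∈ Finset.HasAntidiagonal.antidiagonal k,
      ⁅ofLoop n c (expand taylorPlus ij.1 A),
        ⁅ofLoop n c (expand taylorPlus ij.2 B), ncoeff F (s + k) v⁆⁆
      = ∑ m ∈ Finset.range N, ∑ k ∈ Finset.range (m + 1), ⁅ofLoop n c (expand taylorPlus k A),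
          ⁅ofLoop n c (expand taylorPlus (m - k) B), ncoeff F (s + (k + (m - k) : ℕ)) v⁆⁆ := by
    refine Finset.sum_congr rfl fun m _ => ?_
    rw [Finset.Nat.sum_antidiagonal_eq_sum_range_succ_mk]
    refine Finset.sum_congr rfl fun k hk => ?_
    rw [Finset.mem_range] at hk
    rw [show k + (m - k) = m by omega]
  have f2 : ∑ k ∈ Finset.range N, ∑ pq ∈ Finset.HasAntidiagonal.antidiagonal k,
      ncoeff F (s - k) ⁅ofLoop n c (expand taylorMinus pq.2 B),
        ⁅ofLoop n c (expand taylorMinus pq.1 A), v⁆⁆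
      = ∑ m ∈ Finset.range N, ∑ k ∈ Finset.range (m + 1), ncoeff F (s - (k + (m - k) : ℕ))
          ⁅ofLoop n c (expand taylorMinus (m - k) B),
            ⁅ofLoop n c (expand taylorMinus k A), v⁆⁆ := by
    refine Finset.sum_congr rfl fun m _ => ?_
    rw [Finset.Nat.sum_antidiagonal_eq_sum_range_succ_mk]
    refine Finset.sum_congr rfl fun k hk => ?_
    rw [Finset.mem_range] at hk
    rw [show k + (m - k) = m by omega]
  rw [f1, f2, ← e1, ← e2]
  abel

theorem sum_antidiagonal_lie {φ : ℂ[X] →+* PowerSeries (LaurentSeries ℂ)} (A B : PolyLoop n)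
    (hφ : ∀ p q, ⁅ofLoop n c (expand φ p A), ofLoop n c (expand φ q B)⁆
      = ofLoop n c ⁅expand φ p A, expand φ q B⁆) (k : ℕ) (w : M) :
    ⁅ofLoop n c (expand φ k ⁅A, B⁆), w⁆
      = (∑ ij ∈ Finset.HasAntidiagonal.antidiagonal k,
          ⁅ofLoop n c (expand φ ij.1 A), ⁅ofLoop n c (expand φ ij.2 B), w⁆⁆)
        - ∑ ij ∈ Finset.HasAntidiagonal.antidiagonal k,
          ⁅ofLoop n c (expand φ ij.1 B), ⁅ofLoop n c (expand φ ij.2 A), w⁆⁆ := by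
  rw [expand_lie, map_sum, sum_lie, ← Finset.Nat.sum_antidiagonal_swap (n := k) (f := fun ij =>
    ⁅ofLoop n c (expand φ ij.1 B), ⁅ofLoop n c (expand φ ij.2 A), w⁆⁆), ← Finset.sum_sub_distrib]
  refine Finset.sum_congr rfl fun ij _ => ?_
  rw [← hφ, lie_lie]
  rfl

theorem lie_fieldAct [IsSmooth n c M] (A B : PolyLoop n) (F : VertexOperator ℂ M) :
    fieldAct c ⁅A, B⁆ F
      = fieldAct c A (fieldAct c B F) - fieldAct c B (fieldAct c A F) := by
  refine vertex_ext fun s v => ?_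
  obtain ⟨N, h1, h2, h3⟩ := ((eventually_fieldAct (c := c) ⁅A, B⁆ F s v).and
    ((eventually_fieldAct_fieldAct (c := c) A B F s v).and
      (eventually_fieldAct_fieldAct (c := c) B A F s v))).exists
  rw [map_sub, Pi.sub_apply, LinearMap.sub_apply, h1, h2, h3]
  have m1 : (∑ p ∈ Finset.range N, ∑ i ∈ Finset.range N, ⁅ofLoop n c (expand taylorPlus i B),
      ncoeff F (s - p + i) ⁅ofLoop n c (expand taylorMinus p A), v⁆⁆)
      = ∑ i ∈ Finset.range N, ∑ p ∈ Finset.range N, ⁅ofLoop n c (expand taylorPlus i B),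
            ncoeff F (s + i - p) ⁅ofLoop n c (expand taylorMinus p A), v⁆⁆ := by
    rw [Finset.sum_comm]
    simp only [sub_add_eq_add_sub]
  have m2 : (∑ p ∈ Finset.range N, ∑ i ∈ Finset.range N, ⁅ofLoop n c (expand taylorPlus i A),
      ncoeff F (s - p + i) ⁅ofLoop n c (expand taylorMinus p B), v⁆⁆)
      = ∑ i ∈ Finset.range N, ∑ p ∈ Finset.range N, ⁅ofLoop n c (expand taylorPlus i A),
            ncoeff F (s + i - p) ⁅ofLoop n c (expand taylorMinus p B), v⁆⁆ := by
    rw [Finset.sum_comm]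
    simp only [sub_add_eq_add_sub]
  have sw : ∀ A B : PolyLoop n, (∑ k ∈ Finset.range N,
      ∑ pq ∈ Finset.HasAntidiagonal.antidiagonal k,
            ncoeff F (s - k) ⁅ofLoop n c (expand taylorMinus pq.2 B),
              ⁅ofLoop n c (expand taylorMinus pq.1 A), v⁆⁆)
      = ∑ k ∈ Finset.range N, ncoeff F (s - k) (∑ pq ∈ Finset.HasAntidiagonal.antidiagonal k,
            ⁅ofLoop n c (expand taylorMinus pq.1 B),
              ⁅ofLoop n c (expand taylorMinus pq.2 A), v⁆⁆) := by
    intro A B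
    refine Finset.sum_congr rfl fun k _ => ?_
    rw [map_sum, ← Finset.Nat.sum_antidiagonal_swap]
    rfl
  simp only [sum_antidiagonal_lie A B (expand_lie_ofLoop_plus A B),
    sum_antidiagonal_lie A B (expand_lie_ofLoop_minus A B), m1, m2, sw, map_sub,
    Finset.sum_sub_distrib]
  abel

/-- The operations `fieldAct` make the space of fields a module over `t⁻¹ gl_n[t⁻¹]`. -/
def fieldActHom (n : ℕ) (c : ℂ) (M : Type*) [AddCommGroup M] [Module ℂ M]
    [LieRingModule (Affine n c) M] [LieModule ℂ (Affine n c) M] [IsSmooth n c M] :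
    gMinus n →ₗ⁅ℂ⁆ Module.End ℂ (VertexOperator ℂ M) where
  toFun A :=
    { toFun := fieldAct c (A : PolyLoop n)
      map_add' := fieldAct_add _
      map_smul' := fieldAct_smul _ }
  map_add' _ _ := LinearMap.ext fun F => add_fieldAct _ _ F
  map_smul' _ _ := LinearMap.ext fun F => smul_fieldAct _ _ F
  map_lie' {_ _} := LinearMap.ext fun F => lie_fieldAct _ _ F

theorem idField_bddBelow (M : Type*) [AddCommGroup M] [Module ℂ M] (v : M) :
    BddBelow (Function.support fun k : ℤ => (if k = 0 then (1 : Module.End ℂ M) else 0) v) := by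
  refine ⟨0, fun k hk => ?_⟩
  by_contra h
  exact hk (by simp [show k ≠ 0 by omega])

/-- The identity field, attached to the vacuum. -/
def idField (M : Type*) [AddCommGroup M] [Module ℂ M] : VertexOperator ℂ M :=
  VertexOperator.of_coeff (fun k => if k = 0 then 1 else 0) (idField_bddBelow M)

theorem ncoeff_idField {M : Type*} [AddCommGroup M] [Module ℂ M] (r : ℤ) (v : M) :
    ncoeff (idField M) r v = if r = -1 then v else 0 := by
  rw [idField, VertexOperator.ncoeff_of_coeff]
  by_cases h : r = -1
  · simp [h]
  · rw [if_neg (by omega), if_neg h, LinearMap.zero_apply]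

/-- The state-field correspondence `Y_M` of a smooth module `M`, on the affine vertex algebra
`V_κ = U(t⁻¹ gl_n[t⁻¹]) v₀`: it sends the vacuum `1` to the identity field and `A b` to
`fieldAct A (Y_M b)`, i.e. products of `x[-k-1]` to normally ordered products of derivatives of the
fields `x(w) = ∑ x[s] w^(-s-1)`. -/
def stateField (n : ℕ) (c : ℂ) (M : Type*) [AddCommGroup M] [Module ℂ M]
    [LieRingModule (Affine n c) M] [LieModule ℂ (Affine n c) M] [IsSmooth n c M] :
    UniversalEnvelopingAlgebra ℂ (gMinus n) →ₗ[ℂ] VertexOperator ℂ M :=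
  (LinearMap.applyₗ (idField M)).comp
    (UniversalEnvelopingAlgebra.lift ℂ (fieldActHom n c M)).toLinearMap

/-- The action of the Fourier coefficient `S_[N]` of a state `S` on a smooth module: the
coefficient of `w^(-N-1)` in the field `Y_M S`. -/
def fourierCoeff (n : ℕ) (c : ℂ) (M : Type*) [AddCommGroup M] [Module ℂ M]
    [LieRingModule (Affine n c) M] [LieModule ℂ (Affine n c) M] [IsSmooth n c M]
    (S : UniversalEnvelopingAlgebra ℂ (gMinus n)) (N : ℤ) : Module.End ℂ M :=
  ncoeff (stateField n c M S) N


/-! ### The Segal-Sugawara vectors -/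

theorem e_mem {n : ℕ} (i j : Fin n) : Matrix.single i j Polynomial.X ∈ gMinus n := fun k l => by
  by_cases h : i = k ∧ j = l
  · obtain ⟨rfl, rfl⟩ := h
    simp
  · simp [Matrix.single_apply_of_ne _ _ _ _ _ h]

/-- `e_ij[-1] = e_ij ⊗ t⁻¹`. -/
def eNeg {n : ℕ} (i j : Fin n) : gMinus n := ⟨Matrix.single i j Polynomial.X, e_mem i j⟩

/-- The derivation of `ℂ[t⁻¹]` that is minus the derivative with respect to `t`, i.e.
`X^2 d/dX` for `X = t⁻¹`. -/
def polyTau : Derivation ℂ ℂ[X] ℂ[X] := (Polynomial.X ^ 2 : ℂ[X]) • Polynomial.derivative'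

/-- The derivation `[τ, x[r]] = -r x[r-1]` of `t⁻¹ gl_n[t⁻¹]`. -/
def gTau (n : ℕ) : gMinus n →ₗ[ℂ] gMinus n where
  toFun A := ⟨(A : PolyLoop n).map polyTau, fun i j => by simp [polyTau]⟩
  map_add' A B := Subtype.ext (by ext1 i j; simp)
  map_smul' a A := Subtype.ext (by ext1 i j; simp)

theorem gTau_lie {n : ℕ} (A B : gMinus n) : gTau n ⁅A, B⁆ = ⁅A, gTau n B⁆ + ⁅gTau n A, B⁆ := by
  have hm : ∀ A B : PolyLoop n, (A * B).map polyTau = A * B.map polyTau + A.map polyTau * B := by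
    intro A B
    ext1 i j
    simp only [Matrix.map_apply, Matrix.mul_apply, Matrix.add_apply, map_sum, Derivation.leibniz,
      smul_eq_mul, Finset.sum_add_distrib]
    simp only [mul_comm]
  have hs : ∀ A B : PolyLoop n, (A - B).map polyTau = A.map polyTau - B.map polyTau := by
    intro A B
    ext1 i j
    simp
  apply Subtype.ext
  change (⁅(A : PolyLoop n), (B : PolyLoop n)⁆).map polyTau
    = ⁅(A : PolyLoop n), (B : PolyLoop n).map polyTau⁆
      + ⁅(A : PolyLoop n).map polyTau, (B : PolyLoop n)⁆
  simp only [Ring.lie_def, hs, hm]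
  abel

/-- The universal enveloping algebra of `t⁻¹ gl_n[t⁻¹]`. -/
abbrev UMinus (n : ℕ) : Type := UniversalEnvelopingAlgebra ℂ (gMinus n)

/-- `A ↦ A + ε [τ, A]`, used to extend the derivation to the enveloping algebra. -/
def dualHom (n : ℕ) : gMinus n →ₗ⁅ℂ⁆ DualNumber (UMinus n) where
  toFun A := TrivSqZeroExt.inl (UniversalEnvelopingAlgebra.ι ℂ A)
    + TrivSqZeroExt.inr (UniversalEnvelopingAlgebra.ι ℂ (gTau n A))
  map_add' A B := by
    ext <;> simp
  map_smul' a A := by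
    ext <;> simp
  map_lie' {A B} := by
    ext
    · simp [Ring.lie_def]
    · rw [gTau_lie, map_add, LieHom.map_lie, LieHom.map_lie, LieHom.map_lie]
      simp only [Ring.lie_def, TrivSqZeroExt.snd_add, TrivSqZeroExt.snd_inl,
        TrivSqZeroExt.snd_inr, TrivSqZeroExt.snd_sub, TrivSqZeroExt.snd_mul,
        TrivSqZeroExt.fst_add, TrivSqZeroExt.fst_inl, TrivSqZeroExt.fst_inr, smul_eq_mul,
        MulOpposite.smul_eq_mul_unop, MulOpposite.unop_op, zero_add, add_zero]
      abel

/-- The derivation `[τ, ·]` of the enveloping algebra that extends `gTau`. -/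
def uTau (n : ℕ) : UMinus n →ₗ[ℂ] UMinus n :=
  (TrivSqZeroExt.sndHom (UMinus n) (UMinus n)).restrictScalars ℂ ∘ₗ
    (UniversalEnvelopingAlgebra.lift ℂ (dualHom n)).toLinearMap

theorem uTau_ι {n : ℕ} (A : gMinus n) : uTau n (UniversalEnvelopingAlgebra.ι ℂ A)
    = UniversalEnvelopingAlgebra.ι ℂ (gTau n A) := by
  simp [uTau, dualHom]

theorem uTau_mul {n : ℕ} (a b : UMinus n) :
    uTau n (a * b) = a * uTau n b + uTau n a * b := by
  have hf : ∀ a, (UniversalEnvelopingAlgebra.lift ℂ (dualHom n) a).fst = a := by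
    intro a
    have : (TrivSqZeroExt.fstHom ℂ (UMinus n) (UMinus n)).comp
        (UniversalEnvelopingAlgebra.lift ℂ (dualHom n)) = AlgHom.id ℂ (UMinus n) := by
      apply UniversalEnvelopingAlgebra.hom_ext
      ext A
      simp [dualHom]
    exact DFunLike.congr_fun this a
  simp [uTau, hf]

/-- The column determinant `∑_σ sgn σ · a_{σ(1)1} ⋯ a_{σ(n)n}` over a noncommutative ring. -/
def columnDet {n : ℕ} {R : Type*} [Ring R] (A : Matrix (Fin n) (Fin n) R) : R :=
  ∑ σ : Equiv.Perm (Fin n), (Equiv.Perm.sign σ : ℤ) • (List.ofFn fun j => A (σ j) j).prod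

/-- An element `∑ τ^k a_k` of the algebra generated by `U(t⁻¹ gl_n[t⁻¹])` and `τ` with
`τ a - a τ = uTau a` is represented by the polynomial with `k`-th coefficient `a_k`. In this
representation `tauRight` is right multiplication by `τ`: `τ^k a τ = τ^(k+1) a - τ^k uTau a`. -/
def tauRight (n : ℕ) : Module.End ℂ (UMinus n)[X] :=
  Polynomial.lsum fun k => (Polynomial.monomial (k + 1)).restrictScalars ℂ
    - ((Polynomial.monomial k).restrictScalars ℂ).comp (uTau n)

/-- Right multiplication by `a`, in the same representation: `τ^k b ↦ τ^k (b a)`. -/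
def mulRightCoeff {n : ℕ} (a : UMinus n) : Module.End ℂ (UMinus n)[X] :=
  Polynomial.lsum fun k =>
    ((Polynomial.monomial k).restrictScalars ℂ).comp (LinearMap.mulRight ℂ a)

theorem tauRight_monomial {n : ℕ} (k : ℕ) (a : UMinus n) : tauRight n (Polynomial.monomial k a)
    = Polynomial.monomial (k + 1) a - Polynomial.monomial k (uTau n a) := by
  simp [tauRight, Polynomial.lsum_apply]

theorem mulRightCoeff_monomial {n : ℕ} (b : UMinus n) (k : ℕ) (a : UMinus n) :
    mulRightCoeff b (Polynomial.monomial k a) = Polynomial.monomial k (a * b) := by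
  simp [mulRightCoeff, Polynomial.lsum_apply]

theorem coeff_tauRight_zero {n : ℕ} (p : (UMinus n)[X]) :
    (tauRight n p).coeff 0 = -uTau n (p.coeff 0) := by
  induction p using Polynomial.induction_on' with
  | add p q hp hq =>
    rw [map_add, Polynomial.coeff_add, Polynomial.coeff_add, hp, hq, map_add, neg_add]
  | monomial k a =>
    rw [tauRight_monomial, Polynomial.coeff_sub, Polynomial.coeff_monomial,
      Polynomial.coeff_monomial, Polynomial.coeff_monomial]
    by_cases h : k = 0 <;> simp [h]

theorem coeff_tauRight_succ {n : ℕ} (p : (UMinus n)[X]) (l : ℕ) :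
    (tauRight n p).coeff (l + 1) = p.coeff l - uTau n (p.coeff (l + 1)) := by
  induction p using Polynomial.induction_on' with
  | add p q hp hq =>
    rw [map_add, Polynomial.coeff_add, Polynomial.coeff_add, Polynomial.coeff_add, hp, hq, map_add]
    abel
  | monomial k a =>
    rw [tauRight_monomial, Polynomial.coeff_sub]
    simp only [Polynomial.coeff_monomial, add_left_inj]
    congr 1
    split_ifs <;> simp

theorem coeff_mulRightCoeff {n : ℕ} (b : UMinus n) (p : (UMinus n)[X]) (l : ℕ) :
    (mulRightCoeff b p).coeff l = p.coeff l * b := by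
  induction p using Polynomial.induction_on' with
  | add p q hp hq => rw [map_add, Polynomial.coeff_add, Polynomial.coeff_add, hp, hq, add_mul]
  | monomial k a =>
    rw [mulRightCoeff_monomial, Polynomial.coeff_monomial, Polynomial.coeff_monomial]
    split_ifs <;> simp

/-- The matrix `τ + E[-1]`, through the right regular representation (hence the opposite ring). -/
def tauMatrix (n : ℕ) : Matrix (Fin n) (Fin n) (Module.End ℂ (UMinus n)[X])ᵐᵒᵖ :=
  Matrix.of fun i j => MulOpposite.op
    ((if i = j then tauRight n else 0) + mulRightCoeff (UniversalEnvelopingAlgebra.ι ℂ (eNeg i j)))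

/-- The vectors `S_ℓ` with `cdet (τ + E[-1]) = ∑_ℓ τ^(n-ℓ) S_ℓ`: the element `cdet (τ + E[-1])` is
applied to `1` in the right regular representation and the coefficient of `τ^(n-ℓ)` is taken. -/
def segalSugawara (n ℓ : ℕ) : UMinus n :=
  ((columnDet (tauMatrix n)).unop (1 : (UMinus n)[X])).coeff (n - ℓ)

/-- The defining identity `cdet (τ + E[-1]) = ∑_ℓ τ^(n-ℓ) S_ℓ` holds in every algebra that contains
an image of `U(t⁻¹ gl_n[t⁻¹])` and an element `τ` with `[τ, a] = uTau a`. -/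
theorem columnDet_eq_sum {n : ℕ} {B : Type*} [Ring B] [Algebra ℂ B] (f : UMinus n →ₐ[ℂ] B)
    (τ : B) (hτ : ∀ a, τ * f a - f a * τ = f (uTau n a)) :
    columnDet (Matrix.of fun i j : Fin n =>
        (if i = j then τ else 0) + f (UniversalEnvelopingAlgebra.ι ℂ (eNeg i j)))
      = ∑ ℓ ∈ Finset.range (n + 1), τ ^ (n - ℓ) * f (segalSugawara n ℓ) := by
  let Φ : (UMinus n)[X] →ₗ[ℂ] B := Polynomial.lsum fun k =>
    (LinearMap.mulLeft ℂ (τ ^ k)).comp f.toLinearMap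
  have hΦ : ∀ k a, Φ (Polynomial.monomial k a) = τ ^ k * f a := by
    intro k a
    simp [Φ, Polynomial.lsum_apply]
  have h1 : ∀ p, Φ (tauRight n p) = Φ p * τ := by
    intro p
    induction p using Polynomial.induction_on' with
    | add p q hp hq => rw [map_add, map_add, hp, hq, map_add, add_mul]
    | monomial k a =>
      rw [tauRight_monomial, map_sub, hΦ, hΦ, hΦ, ← hτ, mul_sub, pow_succ, mul_assoc, mul_assoc]
      abel
  have h2 : ∀ b p, Φ (mulRightCoeff b p) = Φ p * f b := by
    intro b p
    induction p using Polynomial.induction_on' with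
    | add p q hp hq => rw [map_add, map_add, hp, hq, map_add, add_mul]
    | monomial k a =>
      rw [mulRightCoeff_monomial, hΦ, hΦ, map_mul, mul_assoc]
  have h3 : ∀ i j p, Φ ((tauMatrix n i j).unop p) = Φ p * ((if i = j then τ else 0)
      + f (UniversalEnvelopingAlgebra.ι ℂ (eNeg i j))) := by
    intro i j p
    simp only [tauMatrix, Matrix.of_apply, MulOpposite.unop_op, LinearMap.add_apply, map_add, h2,
      mul_add]
    split_ifs
    · rw [h1]
    · simp
  have h4 : ∀ (L : List (Fin n × Fin n)) p, Φ ((L.map fun x => tauMatrix n x.1 x.2).prod.unop p)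
      = Φ p * (L.map fun x => (if x.1 = x.2 then τ else 0)
          + f (UniversalEnvelopingAlgebra.ι ℂ (eNeg x.1 x.2))).prod := by
    intro L
    induction L with
    | nil => intro p; simp
    | cons x L ih =>
      intro p
      rw [List.map_cons, List.prod_cons, List.map_cons, List.prod_cons, MulOpposite.unop_mul,
        Module.End.mul_apply, ih, h3, mul_assoc]
  have d0 : ∀ i j (p : (UMinus n)[X]) (N : ℕ), (∀ k ≥ N, p.coeff k = 0) →
      ∀ k ≥ N + 1, ((tauMatrix n i j).unop p).coeff k = 0 := by
    intro i j p N hp k hk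
    obtain ⟨k, rfl⟩ : ∃ l, k = l + 1 := ⟨k - 1, by omega⟩
    simp only [tauMatrix, Matrix.of_apply, MulOpposite.unop_op, LinearMap.add_apply,
      Polynomial.coeff_add, coeff_mulRightCoeff, hp (k + 1) (by omega), zero_mul, add_zero]
    split_ifs
    · rw [coeff_tauRight_succ, hp k (by omega), hp (k + 1) (by omega), map_zero, sub_zero]
    · simp
  have d1 : ∀ (L : List (Fin n × Fin n)) (p : (UMinus n)[X]) (N : ℕ), (∀ k ≥ N, p.coeff k = 0) →
      ∀ k ≥ N + L.length, ((L.map fun x => tauMatrix n x.1 x.2).prod.unop p).coeff k = 0 := by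
    intro L
    induction L with
    | nil => intro p N hp k hk; simpa using hp k (by simpa using hk)
    | cons x L ih =>
      intro p N hp k hk
      rw [List.map_cons, List.prod_cons, MulOpposite.unop_mul, Module.End.mul_apply]
      exact ih _ (N + 1) (d0 _ _ p N hp) k (by simp at hk; omega)
  set p := (columnDet (tauMatrix n)).unop (1 : (UMinus n)[X]) with hp
  have hpsum : p = ∑ σ : Equiv.Perm (Fin n), (Equiv.Perm.sign σ : ℤ) •
      ((List.ofFn fun j => ((σ j, j) : Fin n × Fin n)).map fun x =>
        tauMatrix n x.1 x.2).prod.unop (1 : (UMinus n)[X]) := by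
    rw [hp, columnDet, Finset.unop_sum, LinearMap.sum_apply]
    refine Finset.sum_congr rfl fun σ _ => ?_
    rw [MulOpposite.unop_smul, LinearMap.smul_apply, List.map_ofFn]
    rfl
  have hdeg : ∀ k ≥ n + 1, p.coeff k = 0 := by
    intro k hk
    rw [hpsum, Polynomial.finsetSum_coeff]
    refine Finset.sum_eq_zero fun σ _ => ?_
    rw [Polynomial.coeff_smul, d1 _ 1 1 ?_ k (by simp; omega), smul_zero]
    intro k hk
    rw [Polynomial.coeff_one, if_neg (by omega)]
  have hval : Φ p = columnDet (Matrix.of fun i j : Fin n =>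
        (if i = j then τ else 0) + f (UniversalEnvelopingAlgebra.ι ℂ (eNeg i j))) := by
    rw [hpsum, map_sum, columnDet]
    refine Finset.sum_congr rfl fun σ _ => ?_
    have h5 : Φ 1 = 1 := by
      rw [← Polynomial.monomial_zero_one, hΦ, pow_zero, one_mul, map_one]
    rw [map_zsmul, h4, h5, one_mul, List.map_ofFn]
    rfl
  rw [← hval, p.as_sum_range' (n + 1) (Nat.lt_succ_of_le (Polynomial.natDegree_le_iff_coeff_eq_zero.mpr
    fun k hk => hdeg k hk)), map_sum, ← Finset.sum_range_reflect]
  refine Finset.sum_congr rfl fun l hl => ?_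
  rw [hΦ]
  rfl

/-- The Fourier coefficients of `e_ij[-1]` are the loops `e_ij[s] = e_ij ⊗ t^s`. -/
theorem fourierCoeff_eNeg [IsSmooth n c M] (i j : Fin n) (s : ℤ) (v : M) :
    fourierCoeff n c M (UniversalEnvelopingAlgebra.ι ℂ (eNeg i j)) s v
      = ⁅ofLoop n c (Matrix.single i j (HahnSeries.single s 1)), v⁆ := by
  have he : ∀ (φ : ℂ[X] →+* PowerSeries (LaurentSeries ℂ)) (p : ℕ),
      expand φ p (Matrix.single i j Polynomial.X)
        = Matrix.single i j (PowerSeries.coeff p (φ Polynomial.X)) := by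
    intro φ p
    ext1 a b
    simp only [expand, Matrix.map_apply, Matrix.single_apply]
    split_ifs <;> simp
  have hY : stateField n c M (UniversalEnvelopingAlgebra.ι ℂ (eNeg i j))
      = fieldAct c (Matrix.single i j Polynomial.X) (idField M) := by
    simp only [stateField, LinearMap.comp_apply, AlgHom.toLinearMap_apply,
      UniversalEnvelopingAlgebra.lift_ι_apply]
    rfl
  obtain ⟨N, h1, h2⟩ := ((eventually_fieldAct (c := c) (Matrix.single i j Polynomial.X)
    (idField M) s v).and (Filter.eventually_gt_atTop (s.natAbs + 1))).exists
  rw [fourierCoeff, hY, h1]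
  simp only [he, ncoeff_idField, taylorPlus, taylorMinus, Polynomial.coe_eval₂RingHom,
    Polynomial.eval₂_X, PowerSeries.coeff_mk]
  rcases lt_or_ge s 0 with h | h
  · rw [Finset.sum_eq_single (-1 - s).toNat, Finset.sum_eq_zero, sub_zero]
    · rw [if_pos (by omega), show -1 - (((-1 - s).toNat : ℕ) : ℤ) = s by omega]
    · intro p _
      split_ifs with h3 h4
      · simp
      · omega
      · rfl
    · intro p _ hp
      rw [if_neg (by omega), lie_zero]
    · intro hp
      rw [Finset.mem_range] at hp
      omega
  · rw [Finset.sum_eq_zero, Finset.sum_eq_single (s + 1).toNat, zero_sub]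
    · rw [if_pos (by omega), if_neg (by omega),
        show (((s + 1).toNat : ℕ) : ℤ) - 1 = s by omega,
        show Matrix.single i j (-(HahnSeries.single s (1 : ℂ)))
          = -Matrix.single i j (HahnSeries.single s (1 : ℂ)) by
          ext1 a b; simp only [Matrix.single_apply, Matrix.neg_apply]; split_ifs <;> simp,
        map_neg, neg_lie, neg_neg]
    · intro p _ hp
      rw [if_neg (by omega)]
    · intro hp
      rw [Finset.mem_range] at hp
      omega
    · intro p _
      rw [if_neg (by omega), lie_zero]

/-! ### The root subalgebra -/

/-- The root function: `m` in the last row, `0` in the rest of the last column, `1` elsewhere. -/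
def rootFunction {n : ℕ} (m : ℕ) (i j : Fin n) : ℤ :=
  if (i : ℕ) + 1 = n then m else if (j : ℕ) + 1 = n then 0 else 1

/-- The space of loops whose `(i, j)` entry lies in `t^r ℂ[[t]]`, `r = rootFunction m i j`. -/
def rootSubspace (n m : ℕ) : Submodule ℂ (Loop n) where
  carrier := {X | ∀ i j, ∀ k < rootFunction m i j, (X i j).coeff k = 0}
  zero_mem' := fun i j k _ => by simp
  add_mem' := fun hX hY i j k hk => by simp [hX i j k hk, hY i j k hk]
  smul_mem' := fun a X hX i j k hk => by simp [hX i j k hk]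

end

end AffineGL

namespace AffineGL

noncomputable section

open scoped Polynomial
open VertexOperator (ncoeff)

/-! ### Modes -/

/-! Expanding the column determinant along a permutation `σ` and moving every `τ` to the left writes
`S_ℓ` as a combination of words in the elements `e_ij[-r-1]`. Such a word has weight `∑ (r + 1) =
ℓ`, since `[τ, ·]` raises the weight by one and leaves the index pairs alone. Its index pairs are
`(σ j, j)` for `j` in a set `K`. As `τ` occurs only on the diagonal, the complement of `K` consists
of fixed points of `σ`, so `σ` permutes `K`: rows and columns of the word form the same set, without
repetition (`Balanced`, `segalSugawara_mem_wordSpan`).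

On a given vector, the `N`-th Fourier coefficient of the field of a word of weight `ℓ` is a finite
combination of products of modes `e_ij[s]` with the same index pairs, in some order, and of total
degree `N + 1 - ℓ`. For `N ≥ m + ℓ - 1` this degree is at least `m`.

Let `m ≥ 1`. A product with balanced index pairs and degree at least `m` has a factor in `k_m^0`.
Otherwise the degrees would be at most `m - 1` in the last row, `-1` in the rest of the last column
and `0` elsewhere; the last index occurs either in no row and no column, or in exactly one of each,
so the total would be at most `0` or `m - 1`. The factor found is commuted to the right until it
meets `v` and kills it. Each commutator term is a shorter product which is still balanced and of the
same degree, so induction on the length finishes the argument (`modeProd_apply_eq_zero`).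

For `m = 0` the count fails: the empty product has degree `0`. But the last row and column of `gl_n`
generate all of it, so `v` is annihilated by `gl_n[[t]]`, and the Fourier coefficients with index `N
≥ 0` of every word annihilate such a vector (`ncoeff_wordField_eq_zero`). The level plays no role in
either case. -/

/-- The loop `e_ij ⊗ t^s`. -/
def elemLoop {n : ℕ} (x : (Fin n × Fin n) × ℤ) : Loop n :=
  Matrix.single x.1.1 x.1.2 (HahnSeries.single x.2 1)

theorem loopDeriv_elemLoop {n : ℕ} (x : (Fin n × Fin n) × ℤ) :
    loopDeriv n (elemLoop x)
      = Matrix.single x.1.1 x.1.2 (HahnSeries.single (x.2 - 1) (x.2 : ℂ)) := by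
  have h : LaurentSeries.derivative ℂ (HahnSeries.single x.2 (1 : ℂ))
      = HahnSeries.single (x.2 - 1) (x.2 : ℂ) := by
    ext k
    rw [LaurentSeries.derivative_apply, LaurentSeries.hasseDeriv_coeff, HahnSeries.coeff_single,
      HahnSeries.coeff_single]
    by_cases hk : k = x.2 - 1
    · subst hk
      simp
    · rw [if_neg hk, if_neg (by push_cast; omega), smul_zero]
  ext1 i j
  simp only [loopDeriv, elemLoop, LinearMap.mapMatrix_apply, Matrix.map_apply, Matrix.single_apply]
  split_ifs
  · exact h
  · exact map_zero _

theorem elemLoop_mul {n : ℕ} (x y : (Fin n × Fin n) × ℤ) :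
    elemLoop x * elemLoop y
      = if x.1.2 = y.1.1 then elemLoop ((x.1.1, y.1.2), x.2 + y.2) else 0 := by
  split_ifs with h
  · simp [elemLoop, ← h]
  · rw [elemLoop, elemLoop, Matrix.single_mul_single_of_ne _ _ _ _ h]

/-- The three alternatives say that the residue vanishes for degree reasons, that the derivative of
`elemLoop y` is zero, or that both trace terms of the form vanish. Contrapositively, a nonzero
central term forces the degrees to cancel and the index pairs to be transposed to each other or both
diagonal. Removing both factors then preserves balance and total degree. -/
theorem killing_elemLoop {n : ℕ} (x y : (Fin n × Fin n) × ℤ)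
    (h : x.2 + y.2 ≠ 0 ∨ y.2 = 0 ∨
      ¬ ((x.1.2 = y.1.1 ∧ x.1.1 = y.1.2) ∨ (x.1.1 = x.1.2 ∧ y.1.1 = y.1.2))) :
    (killing n (elemLoop x) (loopDeriv n (elemLoop y))).coeff (-1) = 0 := by
  obtain ⟨⟨i, j⟩, s⟩ := x
  obtain ⟨⟨k, l⟩, t⟩ := y
  rw [loopDeriv_elemLoop]
  simp only [elemLoop] at h ⊢
  rcases h with h | h | h
  · refine killing_coeff_eq_zero_of fun a b p q => ?_
    rw [Matrix.single_apply, Matrix.single_apply]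
    split_ifs
    · rw [HahnSeries.single_mul_single, HahnSeries.coeff_single_of_ne (by omega)]
    all_goals simp
  · subst h
    refine killing_coeff_eq_zero_of fun a b p q => ?_
    rw [Matrix.single_apply, Matrix.single_apply]
    split_ifs <;> simp
  · rw [not_or, not_and_or, not_and_or] at h
    have h1 : (Matrix.single i j (HahnSeries.single s (1 : ℂ))
        * Matrix.single k l (HahnSeries.single (t - 1) (t : ℂ)) : Loop n).trace = 0 := by
      rcases h.1 with h1 | h1
      · rw [Matrix.single_mul_single_of_ne _ _ _ _ h1, Matrix.trace_zero]
      · by_cases h2 : j = k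
        · subst h2
          rw [Matrix.single_mul_single_same, Matrix.trace_single_eq_of_ne _ _ _ h1]
        · rw [Matrix.single_mul_single_of_ne _ _ _ _ h2, Matrix.trace_zero]
    rw [killing, h1]
    rcases h.2 with h2 | h2
    · rw [Matrix.trace_single_eq_of_ne i j _ h2]; simp
    · rw [Matrix.trace_single_eq_of_ne k l _ h2]; simp

section Modes

variable {n : ℕ} {c : ℂ} {M : Type*} [AddCommGroup M] [Module ℂ M]
  [LieRingModule (Affine n c) M] [LieModule ℂ (Affine n c) M]

/-- The action of `e_ij[s]` on a module. -/
def mode (c : ℂ) (M : Type*) [AddCommGroup M] [Module ℂ M]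
    [LieRingModule (Affine n c) M] [LieModule ℂ (Affine n c) M]
    (x : (Fin n × Fin n) × ℤ) : Module.End ℂ M :=
  LieModule.toEnd ℂ (Affine n c) M (ofLoop n c (elemLoop x))

theorem mode_apply (x : (Fin n × Fin n) × ℤ) (v : M) :
    mode c M x v = ⁅ofLoop n c (elemLoop x), v⁆ := rfl

/-- The commutation relation of matrix units, solved for the product so that it rewrites a factor
past its right neighbour. -/
theorem mode_mul_mode (hone : ∀ w : M, ⁅central n c, w⁆ = w) (x y : (Fin n × Fin n) × ℤ) :
    mode c M x * mode c M y = mode c M y * mode c M x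
      + (if x.1.2 = y.1.1 then mode c M ((x.1.1, y.1.2), x.2 + y.2) else 0)
      - (if y.1.2 = x.1.1 then mode c M ((y.1.1, x.1.2), x.2 + y.2) else 0)
      - (c * (killing n (elemLoop x) (loopDeriv n (elemLoop y))).coeff (-1)) •
        (1 : Module.End ℂ M) := by
  refine LinearMap.ext fun w => ?_
  have h : ⁅⁅ofLoop n c (elemLoop x), ofLoop n c (elemLoop y)⁆, w⁆
      = ⁅ofLoop n c (elemLoop x), ⁅ofLoop n c (elemLoop y), w⁆⁆
        - ⁅ofLoop n c (elemLoop y), ⁅ofLoop n c (elemLoop x), w⁆⁆ := lie_lie _ _ _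
  rw [lie_ofLoop, sub_lie, smul_lie, hone, Ring.lie_def, elemLoop_mul, elemLoop_mul, map_sub,
    sub_lie, add_comm y.2] at h
  simp only [Module.End.mul_apply, LinearMap.sub_apply, LinearMap.add_apply, LinearMap.smul_apply,
    Module.End.one_apply, mode_apply]
  rw [sub_eq_iff_eq_add'.mp h.symm]
  split_ifs <;> simp only [mode_apply, LinearMap.zero_apply, map_zero, zero_lie] <;> abel

/-! ### Balanced products of modes -/

/-- A list of index pairs whose rows and whose columns form the same set, without repetition. -/
def Balanced (P : List (Fin n × Fin n)) : Prop :=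
  ∀ a, (P.map Prod.fst).count a = (P.map Prod.snd).count a ∧ (P.map Prod.snd).count a ≤ 1

/-- The product of the modes in a list. -/
def modeProd (c : ℂ) (M : Type*) [AddCommGroup M] [Module ℂ M]
    [LieRingModule (Affine n c) M] [LieModule ℂ (Affine n c) M]
    (L : List ((Fin n × Fin n) × ℤ)) : Module.End ℂ M :=
  (L.map (mode c M)).prod

theorem modeProd_append (A B : List ((Fin n × Fin n) × ℤ)) :
    modeProd c M (A ++ B) = modeProd c M A * modeProd c M B := by
  simp [modeProd]

theorem modeProd_cons (x : (Fin n × Fin n) × ℤ) (B : List ((Fin n × Fin n) × ℤ)) :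
    modeProd c M (x :: B) = mode c M x * modeProd c M B := by
  simp [modeProd]

theorem modeProd_nil : modeProd c M ([] : List ((Fin n × Fin n) × ℤ)) = 1 := by
  simp [modeProd]

theorem elemLoop_mem_rootSubspace {m : ℕ} (x : (Fin n × Fin n) × ℤ)
    (h : rootFunction m x.1.1 x.1.2 ≤ x.2) : elemLoop x ∈ rootSubspace n m := by
  intro i j k hk
  rw [elemLoop, Matrix.single_apply]
  split_ifs with hij
  · rw [HahnSeries.coeff_single_of_ne]
    rw [← hij.1, ← hij.2] at hk
    omega
  · rfl

/-- Each factor contributes at most its root function minus one. This is exactly `m - 1` at the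
corner, where both counts increase, and `-1` in the rest of the last column; the bound `m` for the
rest of the last row is not sharp. -/
theorem sum_le_of_lt_rootFunction (hn : 0 < n) {m : ℕ} (L : List ((Fin n × Fin n) × ℤ))
    (h : ∀ x ∈ L, x.2 < rootFunction m x.1.1 x.1.2) :
    (L.map Prod.snd).sum
      ≤ (m : ℤ) * ((L.map Prod.fst).map Prod.fst).count (⟨n - 1, by omega⟩ : Fin n)
        - ((L.map Prod.fst).map Prod.snd).count (⟨n - 1, by omega⟩ : Fin n) := by
  induction L with
  | nil => simp
  | cons x L ih =>
    have h1 := ih fun y hy => h y (List.mem_cons_of_mem _ hy)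
    have h2 := h x List.mem_cons_self
    have e : ∀ i : Fin n, ((i : ℕ) + 1 = n) ↔ i = ⟨n - 1, by omega⟩ := fun i => by
      rw [Fin.ext_iff]; dsimp only; omega
    simp only [rootFunction, e] at h2
    simp only [List.map_cons, List.sum_cons, List.count_cons, beq_iff_eq, Nat.cast_add, mul_add]
    split_ifs at h2 ⊢ <;> push_cast <;> linarith

theorem exists_rootFunction_le (hn : 0 < n) {m : ℕ} (hm : 1 ≤ m)
    (L : List ((Fin n × Fin n) × ℤ)) (hL : Balanced (L.map Prod.fst))
    (hs : (m : ℤ) ≤ (L.map Prod.snd).sum) :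
    ∃ x ∈ L, rootFunction m x.1.1 x.1.2 ≤ x.2 := by
  by_contra! hc
  have h1 := sum_le_of_lt_rootFunction hn L hc
  obtain ⟨h2, h3⟩ := hL ⟨n - 1, by omega⟩
  rw [h2] at h1
  -- The last index occurs zero times or once, which bounds the total degree by `0` or `m - 1`. The
  -- first value contradicts the lower bound `m` only because `m ≥ 1`.
  interval_cases h : ((L.map Prod.fst).map Prod.snd).count (⟨n - 1, by omega⟩ : Fin n) <;>
    push_cast at h1 <;> omega

/-- Some factor annihilates `v`, and the class of balanced products of degree at least `m` is closed
under the corrections that arise when this factor is moved to the right end. -/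
theorem modeProd_apply_eq_zero (hone : ∀ w : M, ⁅central n c, w⁆ = w) (hn : 0 < n) {m : ℕ}
    (hm : 1 ≤ m) {v : M} (hv : ∀ X ∈ rootSubspace n m, ⁅ofLoop n c X, v⁆ = 0)
    (L : List ((Fin n × Fin n) × ℤ)) (hL : Balanced (L.map Prod.fst))
    (hs : (m : ℤ) ≤ (L.map Prod.snd).sum) : modeProd c M L v = 0 := by
  induction hk : L.length using Nat.strong_induction_on generalizing L with
  | h k ih =>
  obtain ⟨x, hx, hr⟩ := exists_rootFunction_le hn hm L hL hs
  obtain ⟨A, B, rfl⟩ := List.append_of_mem hx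
  clear hx
  -- Inner induction on the number of factors standing between `x` and `v`; the outer one, on the
  -- length, handles the commutators.
  induction B generalizing A with
  | nil =>
    rw [modeProd_append, modeProd_cons, modeProd_nil, mul_one, Module.End.mul_apply, mode_apply,
      hv _ (elemLoop_mem_rootSubspace x hr), map_zero]
  | cons y B ihB =>
    rw [modeProd_append, modeProd_cons, modeProd_cons, ← mul_assoc (mode c M x),
      mode_mul_mode hone]
    have e1 := ihB (A ++ [y]) (by
      intro a
      have := hL a
      simp only [List.map_append, List.map_cons, List.map_nil, List.count_append,
        List.count_cons, List.count_nil] at this ⊢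
      omega) (by
      simp only [List.map_append, List.map_cons, List.map_nil, List.sum_append,
        List.sum_cons, List.sum_nil] at hs ⊢
      omega) (by simp at hk ⊢; omega)
    -- Contracting the common index deletes it once from the rows and once from the columns, and the
    -- degrees add.
    have e2 : x.1.2 = y.1.1 →
        modeProd c M (A ++ ((x.1.1, y.1.2), x.2 + y.2) :: B) v = 0 := fun h => by
      refine ih (k - 1) (by simp at hk; omega) _ ?_ ?_ (by simp at hk ⊢; omega)
      · intro a
        have := hL a
        simp only [List.map_append, List.map_cons, List.count_append, List.count_cons, h] at this ⊢
        omega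
      · simp only [List.map_append, List.map_cons, List.sum_append, List.sum_cons] at hs ⊢
        omega
    have e3 : y.1.2 = x.1.1 →
        modeProd c M (A ++ ((y.1.1, x.1.2), x.2 + y.2) :: B) v = 0 := fun h => by
      refine ih (k - 1) (by simp at hk; omega) _ ?_ ?_ (by simp at hk ⊢; omega)
      · intro a
        have := hL a
        simp only [List.map_append, List.map_cons, List.count_append, List.count_cons, h] at this ⊢
        omega
      · simp only [List.map_append, List.map_cons, List.sum_append, List.sum_cons] at hs ⊢
        omega
    have e4 : (c * (killing n (elemLoop x) (loopDeriv n (elemLoop y))).coeff (-1)) •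
        modeProd c M (A ++ B) v = 0 := by
      by_cases h : x.2 + y.2 ≠ 0 ∨ y.2 = 0 ∨
        ¬ ((x.1.2 = y.1.1 ∧ x.1.1 = y.1.2) ∨ (x.1.1 = x.1.2 ∧ y.1.1 = y.1.2))
      · rw [killing_elemLoop x y h, mul_zero, zero_smul]
      -- A nonzero central term: the two degrees sum to `0`, and the two index pairs use the same
      -- rows as columns, so the rest stays balanced with unchanged degree.
      · push Not at h
        rw [ih (k - 2) (by simp at hk; omega) (A ++ B) ?_ ?_ (by simp at hk ⊢; omega), smul_zero]
        · intro a
          have := hL a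
          simp only [List.map_append, List.map_cons, List.count_append,
            List.count_cons] at this ⊢
          rcases h.2.2 with ⟨h1, h2⟩ | ⟨h1, h2⟩ <;> rw [h1, h2] at this <;> omega
        · simp only [List.map_append, List.map_cons, List.sum_append, List.sum_cons] at hs ⊢
          omega
    simp only [List.append_assoc, List.singleton_append, modeProd_append, modeProd_cons,
      Module.End.mul_apply] at e1 e2 e3 e4
    simp only [Module.End.mul_apply, LinearMap.sub_apply, LinearMap.add_apply,
      LinearMap.smul_apply, Module.End.one_apply, map_sub, map_add, map_smul, e1, e4, zero_add,
      sub_zero]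
    split_ifs with h1 h2 h2
    · rw [e2 h1, e3 h2, sub_zero]
    · rw [e2 h1, LinearMap.zero_apply, map_zero, sub_zero]
    · rw [e3 h2, LinearMap.zero_apply, map_zero, sub_zero]
    · rw [LinearMap.zero_apply, map_zero, sub_zero]

/-- A vector annihilated by `k_0^0` is annihilated by `gl_n[[t]]`. -/
theorem lie_eq_zero_of_vanishesBelow_zero (hone : ∀ w : M, ⁅central n c, w⁆ = w) {v : M}
    (hv : ∀ X ∈ rootSubspace n 0, ⁅ofLoop n c X, v⁆ = 0) (X : Loop n) (hX : VanishesBelow 0 X) :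
    ⁅ofLoop n c X, v⁆ = 0 := by
  have h0 : ∀ i j : Fin n, rootFunction 0 i j ≤ 0 → mode c M ((i, j), 0) v = 0 :=
    fun i j h => hv _ (elemLoop_mem_rootSubspace _ h)
  have h1 : ∀ i j : Fin n, mode c M ((i, j), 0) v = 0 := by
    intro i j
    have hpos := i.pos
    let l : Fin n := ⟨n - 1, by omega⟩
    have hl : ∀ k : Fin n, rootFunction 0 l k ≤ 0 ∧ rootFunction 0 k l ≤ 0 := by
      intro k
      have : (l : ℕ) + 1 = n := by simp only [l]; omega
      simp [rootFunction, this]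
    -- With `l` the last index, `e_ij = [e_il, e_lj] + δ_ij e_ll`; there is no central term in
    -- degree `0`.
    have h := DFunLike.congr_fun (mode_mul_mode (c := c) hone ((i, l), 0) ((l, j), 0)) v
    rw [killing_elemLoop _ _ (Or.inr (Or.inl rfl))] at h
    simp only [Module.End.mul_apply, LinearMap.sub_apply, LinearMap.add_apply,
      h0 l j (hl j).1, h0 i l (hl i).2, map_zero, if_true, add_zero, mul_zero,
      zero_smul, sub_zero, zero_add] at h
    split_ifs at h
    · rw [h0 l l (hl l).1, sub_zero] at h
      exact h.symm
    · rw [LinearMap.zero_apply, sub_zero] at h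
      exact h.symm
  -- Subtracting the constant terms leaves a matrix with entries in `t ℂ[[t]]`, which lies in
  -- `k_0^0`.
  have h2 : X - ∑ i, ∑ j, (X i j).coeff 0 • elemLoop ((i, j), 0) ∈ rootSubspace n 0 := by
    intro i j k hk
    have hk1 : k < 1 := lt_of_lt_of_le hk (by simp only [rootFunction]; split_ifs <;> simp)
    have e : (∑ a, ∑ b, (X a b).coeff 0 • elemLoop ((a, b), 0) : Loop n) i j
        = HahnSeries.single 0 ((X i j).coeff 0) := by
      simp only [Matrix.sum_apply, Matrix.smul_apply, elemLoop, Matrix.single_apply]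
      rw [Finset.sum_eq_single i, Finset.sum_eq_single j]
      · rw [if_pos ⟨rfl, rfl⟩, ← HahnSeries.C_mul_eq_smul]
        exact mul_one _
      · intro b _ hb
        rw [if_neg (by tauto), smul_zero]
      · simp
      · intro a _ ha
        exact Finset.sum_eq_zero fun b _ => by rw [if_neg (by tauto), smul_zero]
      · simp
    rw [Matrix.sub_apply, e, HahnSeries.coeff_sub]
    rcases eq_or_ne k 0 with rfl | hk0
    · simp
    · rw [hX i j k (by omega), HahnSeries.coeff_single_of_ne hk0, sub_zero]
  have h3 := hv _ h2
  simp only [map_sub, map_sum, map_smul, sub_lie, sum_lie, smul_lie, ← mode_apply, h1, smul_zero,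
    Finset.sum_const_zero, sub_zero] at h3
  exact h3

end Modes

/-! ### Expansions of monomials -/

/-- A power series whose `k`-th coefficient is a multiple of `t^(u + ε k)`. -/
def IsHomogeneous (u ε : ℤ) (P : PowerSeries (LaurentSeries ℂ)) : Prop :=
  ∀ k : ℕ, ∃ a : ℂ, PowerSeries.coeff k P = HahnSeries.single (u + ε * k) a

theorem IsHomogeneous.mul {u u' ε : ℤ} {P Q : PowerSeries (LaurentSeries ℂ)}
    (hP : IsHomogeneous u ε P) (hQ : IsHomogeneous u' ε Q) :
    IsHomogeneous (u + u') ε (P * Q) := by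
  intro k
  choose a ha using hP
  choose b hb using hQ
  refine ⟨∑ ij ∈ Finset.HasAntidiagonal.antidiagonal k, a ij.1 * b ij.2, ?_⟩
  rw [PowerSeries.coeff_mul]
  refine Eq.trans ?_ (map_sum (HahnSeries.single.addMonoidHom (u + u' + ε * (k : ℤ))) _ _).symm
  refine Finset.sum_congr rfl fun ij hij => ?_
  rw [Finset.HasAntidiagonal.mem_antidiagonal] at hij
  rw [ha, hb, HahnSeries.single_mul_single, ← hij, Nat.cast_add,
    show u + ε * (ij.1 : ℤ) + (u' + ε * ij.2) = u + u' + ε * (ij.1 + ij.2) by ring]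
  rfl

theorem IsHomogeneous.pow_succ {u ε : ℤ} {P : PowerSeries (LaurentSeries ℂ)}
    (hP : IsHomogeneous u ε P) (r : ℕ) : IsHomogeneous ((r + 1) * u) ε (P ^ (r + 1)) := by
  induction r with
  | zero => simpa using hP
  | succ r ih =>
    rw [_root_.pow_succ]
    have := ih.mul hP
    rwa [show ((r : ℤ) + 1) * u + u = ((r + 1 : ℕ) + 1) * u by push_cast; ring] at this

theorem isHomogeneous_taylorPlus_X : IsHomogeneous (-1) (-1) (taylorPlus Polynomial.X) := by
  intro k
  refine ⟨1, ?_⟩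
  simp only [taylorPlus, Polynomial.coe_eval₂RingHom, Polynomial.eval₂_X, PowerSeries.coeff_mk]
  ring_nf

theorem isHomogeneous_taylorMinus_X : IsHomogeneous (-1) 1 (taylorMinus Polynomial.X) := by
  intro k
  -- This expansion has no term with `k = 0`; homogeneity allows the zero multiple there.
  refine ⟨if k = 0 then 0 else -1, ?_⟩
  simp only [taylorMinus, Polynomial.coe_eval₂RingHom, Polynomial.eval₂_X, PowerSeries.coeff_mk]
  split_ifs
  · rw [map_zero]
  · rw [HahnSeries.single_neg]
    ring_nf

/-- The matrix `e_ij ⊗ t^(-r-1)`. -/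
def elemPoly {n : ℕ} (x : (Fin n × Fin n) × ℕ) : PolyLoop n :=
  Matrix.single x.1.1 x.1.2 (Polynomial.X ^ (x.2 + 1))

/-- Only the degree of each mode in the expansion matters for the vanishing argument, so the
binomial coefficients are left unspecified. -/
theorem exists_expand_elemPoly {n : ℕ} {φ : ℂ[X] →+* PowerSeries (LaurentSeries ℂ)} {ε : ℤ}
    (hφ : IsHomogeneous (-1) ε (φ Polynomial.X)) (x : (Fin n × Fin n) × ℕ) (k : ℕ) :
    ∃ a : ℂ, expand φ k (elemPoly x) = a • elemLoop (x.1, -((x.2 : ℤ) + 1) + ε * k) := by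
  obtain ⟨a, ha⟩ := hφ.pow_succ x.2 k
  refine ⟨a, ?_⟩
  ext1 i j
  simp only [expand, elemPoly, elemLoop, Matrix.map_apply, Matrix.smul_apply, Matrix.single_apply]
  split_ifs
  · rw [map_pow, ha, ← HahnSeries.C_mul_eq_smul, HahnSeries.C_apply, HahnSeries.single_mul_single,
      mul_one, zero_add, mul_neg_one]
  · simp

/-! ### Fields of words -/

section Fields

variable {n : ℕ} {c : ℂ} {M : Type*} [AddCommGroup M] [Module ℂ M]
  [LieRingModule (Affine n c) M] [LieModule ℂ (Affine n c) M] [IsSmooth n c M]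

/-- The weight of a product of elements `e_ij ⊗ t^(-r-1)`. -/
def weight (w : List ((Fin n × Fin n) × ℕ)) : ℤ := (w.map fun x => (x.2 : ℤ) + 1).sum

theorem weight_cons (x : (Fin n × Fin n) × ℕ) (w : List ((Fin n × Fin n) × ℕ)) :
    weight (x :: w) = x.2 + 1 + weight w := by
  simp [weight]

/-- The field of a product of elements `e_ij ⊗ t^(-r-1)`. -/
def wordField (c : ℂ) (M : Type*) [AddCommGroup M] [Module ℂ M]
    [LieRingModule (Affine n c) M] [LieModule ℂ (Affine n c) M] [IsSmooth n c M]
    (w : List ((Fin n × Fin n) × ℕ)) : VertexOperator ℂ M :=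
  w.foldr (fun x F => fieldAct c (elemPoly x) F) (idField M)

/-- The coefficient with index `s` of the field of `w` has degree `s + 1 - weight w`. The lists `A`
and `B` collect the modes already split off to the left and to the right of the remaining field, so
that the induction on `w` ends with a single product of modes. -/
theorem modeProd_wordField_eq_zero {m : ℤ} {v : M}
    (hv : ∀ L : List ((Fin n × Fin n) × ℤ), Balanced (L.map Prod.fst) →
      m ≤ (L.map Prod.snd).sum → modeProd c M L v = 0)
    (w : List ((Fin n × Fin n) × ℕ)) (A B : List ((Fin n × Fin n) × ℤ)) (s : ℤ)
    (hb : Balanced (A.map Prod.fst ++ w.map Prod.fst ++ B.map Prod.fst))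
    (hs : m + weight w ≤ (A.map Prod.snd).sum + (s + 1) + (B.map Prod.snd).sum) :
    modeProd c M A (ncoeff (wordField c M w) s (modeProd c M B v)) = 0 := by
  induction w generalizing A B s with
  | nil =>
    rw [wordField, List.foldr_nil, ncoeff_idField]
    split_ifs with h
    · rw [← Module.End.mul_apply, ← modeProd_append]
      refine hv _ (by simpa using hb) ?_
      simp [weight] at hs ⊢
      omega
    · rw [map_zero]
  | cons x w ih =>
    -- On a fixed vector the normally ordered product is a finite sum, so it suffices to kill each
    -- term.
    obtain ⟨N, hN⟩ := (eventually_fieldAct (c := c) (elemPoly x) (wordField c M w) s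
      (modeProd c M B v)).exists
    rw [wordField, List.foldr_cons, ← wordField, hN, map_sub, map_sum, map_sum,
      Finset.sum_eq_zero, Finset.sum_eq_zero, sub_zero]
    · intro p _
      obtain ⟨a, ha⟩ := exists_expand_elemPoly isHomogeneous_taylorMinus_X x p
      -- The shift of the mode by `p` offsets the shift of the field index to `s - p`, so the total
      -- degree is unchanged.
      have h := ih A ((x.1, -((x.2 : ℤ) + 1) + 1 * p) :: B) (s - p) (fun i => by
        have := hb i
        simp only [List.map_append, List.map_cons, List.count_append, List.count_cons] at this ⊢
        omega) (by
        rw [weight_cons] at hs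
        simp only [List.map_cons, List.sum_cons]
        omega)
      rw [modeProd_cons, Module.End.mul_apply, mode_apply] at h
      rw [ha, map_smul, smul_lie, map_smul, map_smul, h, smul_zero]
    · intro j _
      obtain ⟨a, ha⟩ := exists_expand_elemPoly isHomogeneous_taylorPlus_X x j
      have h := ih (A ++ [(x.1, -((x.2 : ℤ) + 1) + -1 * j)]) B (s + j) (fun i => by
        have := hb i
        simp only [List.map_append, List.map_cons, List.map_nil, List.count_append,
          List.count_cons, List.count_nil] at this ⊢
        omega) (by
        rw [weight_cons] at hs
        simp only [List.map_append, List.map_cons, List.map_nil, List.sum_append, List.sum_cons,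
          List.sum_nil]
        omega)
      rw [modeProd_append, modeProd_cons, modeProd_nil, mul_one, Module.End.mul_apply,
        mode_apply] at h
      rw [ha, map_smul, smul_lie, map_smul, h, smul_zero]

/-- The vector behaves like a vacuum. In the normally ordered product the modes on the right have
nonnegative powers of `t` and kill `v`, while those on the left follow a coefficient of index `s + j
≥ 0` of the shorter word. -/
theorem ncoeff_wordField_eq_zero {v : M}
    (hv : ∀ X : Loop n, VanishesBelow 0 X → ⁅ofLoop n c X, v⁆ = 0)
    (w : List ((Fin n × Fin n) × ℕ)) (s : ℤ) (hs : 0 ≤ s) :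
    ncoeff (wordField c M w) s v = 0 := by
  induction w generalizing s with
  | nil => rw [wordField, List.foldr_nil, ncoeff_idField, if_neg (by omega)]
  | cons x w ih =>
    obtain ⟨N, hN⟩ := (eventually_fieldAct (c := c) (elemPoly x) (wordField c M w) s v).exists
    rw [wordField, List.foldr_cons, ← wordField, hN, Finset.sum_eq_zero, Finset.sum_eq_zero,
      sub_zero]
    · intro p _
      rw [hv (expand taylorMinus p (elemPoly x)) fun i j k hk => taylorMinus_coeff_neg _ p k hk,
        map_zero]
    · intro j _
      rw [ih _ (by omega), lie_zero]

end Fields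

/-! ### The words in the Segal-Sugawara vectors -/

/-- The element `e_ij[-r-1]` of `t⁻¹ gl_n[t⁻¹]`. -/
def elemNeg {n : ℕ} (x : (Fin n × Fin n) × ℕ) : gMinus n :=
  ⟨elemPoly x, fun k l => by
    rw [elemPoly, Matrix.single_apply]
    split_ifs <;> simp⟩

theorem gTau_elemNeg {n : ℕ} (x : (Fin n × Fin n) × ℕ) :
    gTau n (elemNeg x) = ((x.2 : ℂ) + 1) • elemNeg (x.1, x.2 + 1) := by
  apply Subtype.ext
  change (elemPoly x).map polyTau = ((x.2 : ℂ) + 1) • elemPoly (x.1, x.2 + 1)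
  ext1 i j
  simp only [elemPoly, Matrix.map_apply, Matrix.smul_apply, Matrix.single_apply]
  split_ifs
  · simp only [polyTau, Derivation.smul_apply, Polynomial.derivative'_apply,
      Polynomial.derivative_X_pow, smul_eq_mul, Polynomial.smul_eq_C_mul]
    push_cast
    simp
    ring
  · simp

/-- The product of the elements `e_ij[-r-1]` in a list. -/
def word {n : ℕ} (w : List ((Fin n × Fin n) × ℕ)) : UMinus n :=
  (w.map fun x => UniversalEnvelopingAlgebra.ι ℂ (elemNeg x)).prod

theorem word_cons {n : ℕ} (x : (Fin n × Fin n) × ℕ) (w : List ((Fin n × Fin n) × ℕ)) :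
    word (x :: w) = UniversalEnvelopingAlgebra.ι ℂ (elemNeg x) * word w := by
  simp [word]

theorem stateField_word {n : ℕ} {c : ℂ} {M : Type*} [AddCommGroup M] [Module ℂ M]
    [LieRingModule (Affine n c) M] [LieModule ℂ (Affine n c) M] [IsSmooth n c M]
    (w : List ((Fin n × Fin n) × ℕ)) : stateField n c M (word w) = wordField c M w := by
  induction w with
  | nil => simp [stateField, word, wordField]
  | cons x w ih =>
    rw [wordField, List.foldr_cons, ← wordField, ← ih, word_cons]
    simp only [stateField, LinearMap.comp_apply, AlgHom.toLinearMap_apply, map_mul,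
      UniversalEnvelopingAlgebra.lift_ι_apply]
    rfl

/-- The span of the words of weight `d` whose list of index pairs lies in `C`. -/
def wordSpan {n : ℕ} (C : Set (List (Fin n × Fin n))) (d : ℤ) : Submodule ℂ (UMinus n) :=
  Submodule.span ℂ {a | ∃ w, w.map Prod.fst ∈ C ∧ weight w = d ∧ a = word w}

theorem word_mem_wordSpan {n : ℕ} {C : Set (List (Fin n × Fin n))}
    {w : List ((Fin n × Fin n) × ℕ)} (h : w.map Prod.fst ∈ C) : word w ∈ wordSpan C (weight w) :=
  Submodule.subset_span ⟨w, h, rfl, rfl⟩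

theorem wordSpan_mono {n : ℕ} {C C' : Set (List (Fin n × Fin n))} (h : C ⊆ C') (d : ℤ) :
    wordSpan C d ≤ wordSpan C' d :=
  Submodule.span_mono fun _ ⟨w, h1, h2, h3⟩ => ⟨w, h h1, h2, h3⟩

/-- By the Leibniz rule, each term replaces one `e_ij[-r-1]` by a multiple of `e_ij[-r-2]`. -/
theorem uTau_word_mem {n : ℕ} (w : List ((Fin n × Fin n) × ℕ)) :
    uTau n (word w) ∈ wordSpan {w.map Prod.fst} (weight w + 1) := by
  induction w with
  | nil =>
    -- The Leibniz rule for `1 * 1` shows that the derivation kills `1`.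
    have h := uTau_mul (1 : UMinus n) 1
    rw [one_mul, mul_one, one_mul, left_eq_add] at h
    rw [show word ([] : List ((Fin n × Fin n) × ℕ)) = 1 by simp [word], h]
    exact zero_mem _
  | cons x w ih =>
    rw [word_cons, uTau_mul, uTau_ι, gTau_elemNeg]
    refine add_mem ?_ ?_
    · refine Submodule.span_induction (p := fun a _ => UniversalEnvelopingAlgebra.ι ℂ (elemNeg x)
        * a ∈ wordSpan {(x :: w).map Prod.fst} (weight (x :: w) + 1)) ?_ ?_ ?_ ?_ ih
      · rintro _ ⟨w', h1, h2, rfl⟩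
        rw [Set.mem_singleton_iff] at h1
        rw [← word_cons, show weight (x :: w) + 1 = weight (x :: w') by
          rw [weight_cons, weight_cons, h2]; ring]
        exact word_mem_wordSpan (by simp [h1])
      · simp
      · intro a b _ _ ha hb
        rw [mul_add]
        exact add_mem ha hb
      · intro r a _ ha
        rw [mul_smul_comm]
        exact Submodule.smul_mem _ _ ha
    · rw [map_smul, smul_mul_assoc, ← word_cons]
      refine Submodule.smul_mem _ _ ?_
      rw [show weight (x :: w) + 1 = weight ((x.1, x.2 + 1) :: w) by
        rw [weight_cons, weight_cons]; push_cast; ring]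
      exact word_mem_wordSpan (by simp)

theorem uTau_mem_wordSpan {n : ℕ} {C : Set (List (Fin n × Fin n))} {d : ℤ} {a : UMinus n}
    (ha : a ∈ wordSpan C d) : uTau n a ∈ wordSpan C (d + 1) := by
  refine Submodule.span_induction (p := fun a _ => uTau n a ∈ wordSpan C (d + 1))
    ?_ ?_ ?_ ?_ ha
  · rintro _ ⟨w, h1, rfl, rfl⟩
    exact wordSpan_mono (Set.singleton_subset_iff.mpr h1) _ (uTau_word_mem w)
  · simp
  · intro a b _ _ ha hb
    rw [map_add]
    exact add_mem ha hb
  · intro r a _ ha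
    rw [map_smul]
    exact Submodule.smul_mem _ _ ha

theorem mul_eNeg_mem_wordSpan {n : ℕ} {C C' : Set (List (Fin n × Fin n))} {i j : Fin n}
    (h : ∀ P ∈ C, P ++ [(i, j)] ∈ C') {d : ℤ} {a : UMinus n} (ha : a ∈ wordSpan C d) :
    a * UniversalEnvelopingAlgebra.ι ℂ (eNeg i j) ∈ wordSpan C' (d + 1) := by
  have e : (eNeg i j : gMinus n) = elemNeg ((i, j), 0) :=
    Subtype.ext (by simp [eNeg, elemNeg, elemPoly])
  refine Submodule.span_induction (p := fun a _ => a * UniversalEnvelopingAlgebra.ι ℂ (eNeg i j)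
    ∈ wordSpan C' (d + 1)) ?_ ?_ ?_ ?_ ha
  · rintro _ ⟨w, h1, rfl, rfl⟩
    rw [show word w * UniversalEnvelopingAlgebra.ι ℂ (eNeg i j) = word (w ++ [((i, j), 0)]) by
      simp [word, e], show weight w + 1 = weight (w ++ [((i, j), 0)]) by simp [weight]]
    exact word_mem_wordSpan (by simpa using h _ h1)
  · simp
  · intro a b _ _ ha hb
    rw [add_mul]
    exact add_mem ha hb
  · intro r a _ ha
    rw [smul_mul_assoc]
    exact Submodule.smul_mem _ _ ha

/-! ### Index pairs in the expansion of the column determinant -/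

/-- The lists of pairs `(σ j, j)` for `j` in a sublist of `J` that contains all `j` in `J` which
are not fixed by `σ`. -/
def columnPairs {n : ℕ} (σ : Equiv.Perm (Fin n)) (J : List (Fin n)) :
    Set (List (Fin n × Fin n)) :=
  {P | ∃ K : List (Fin n), K.Sublist J ∧ (∀ j ∈ J, σ j ≠ j → j ∈ K) ∧
    P = K.map fun j => (σ j, j)}

theorem balanced_of_mem_columnPairs {n : ℕ} (σ : Equiv.Perm (Fin n)) {P : List (Fin n × Fin n)}
    (hP : P ∈ columnPairs σ (List.finRange n)) : Balanced P := by
  obtain ⟨K, h1, h2, rfl⟩ := hP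
  have hK : K.Nodup := h1.nodup (List.nodup_finRange n)
  -- `σ` preserves `K`: if `a` is not fixed by `σ`, neither is its preimage, and `K` contains all
  -- points that are not fixed.
  have hmem : ∀ a, σ.symm a ∈ K ↔ a ∈ K := by
    intro a
    by_cases h : σ a = a
    · rw [show σ.symm a = a by rw [Equiv.symm_apply_eq, h]]
    · have h' : σ (σ.symm a) ≠ σ.symm a := by
        rw [Equiv.apply_symm_apply]
        intro e
        apply h
        conv_lhs => rw [e]
        exact σ.apply_symm_apply a
      exact iff_of_true (h2 _ (List.mem_finRange _) h') (h2 _ (List.mem_finRange _) h)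
  intro a
  have e : List.count a (K.map σ) = List.count (σ.symm a) K := by
    conv_lhs => rw [← σ.apply_symm_apply a]
    exact List.count_map_of_injective _ _ σ.injective _
  simp only [List.map_map]
  rw [show (Prod.fst ∘ fun j => (σ j, j)) = σ from rfl,
    show (Prod.snd ∘ fun j => (σ j, j)) = id from rfl, List.map_id, e, hK.count, hK.count]
  simp only [hmem]
  exact ⟨trivial, by split_ifs <;> simp⟩

/-- A factor `τ` either raises the power of `τ` or differentiates the coefficient, and it is
available only when `σ j = j`, so that `j` may be left out. A factor `e_{σ(j) j}[-1]` appends the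
pair and adds one to the weight. In all cases weight plus power of `τ` grows by one. -/
theorem coeff_tauMatrix_mem {n : ℕ} (σ : Equiv.Perm (Fin n)) (j : Fin n) (J : List (Fin n))
    (p : (UMinus n)[X])
    (hp : ∀ q : ℕ, p.coeff q ∈ wordSpan (columnPairs σ J) ((J.length : ℤ) - q)) (q : ℕ) :
    ((tauMatrix n (σ j) j).unop p).coeff q
      ∈ wordSpan (columnPairs σ (J ++ [j])) (((J ++ [j]).length : ℤ) - q) := by
  have hlen : (((J ++ [j]).length : ℤ) - q) = (J.length : ℤ) - q + 1 := by
    simp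
    ring
  simp only [tauMatrix, Matrix.of_apply, MulOpposite.unop_op, LinearMap.add_apply,
    Polynomial.coeff_add, coeff_mulRightCoeff, hlen]
  refine add_mem ?_ (mul_eNeg_mem_wordSpan ?_ (hp q))
  · split_ifs with h
    · have hsub : columnPairs σ J ⊆ columnPairs σ (J ++ [j]) := by
        rintro _ ⟨K, h1, h2, rfl⟩
        refine ⟨K, h1.trans (List.sublist_append_left _ _), fun i hi hne => ?_, rfl⟩
        rcases List.mem_append.mp hi with hi | hi
        · exact h2 i hi hne
        · rw [List.mem_singleton] at hi
          exact absurd (hi ▸ h) hne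
      cases q with
      | zero =>
        rw [coeff_tauRight_zero]
        exact neg_mem (wordSpan_mono hsub _ (uTau_mem_wordSpan (hp 0)))
      | succ q =>
        rw [coeff_tauRight_succ]
        refine sub_mem (wordSpan_mono hsub _ ?_)
          (wordSpan_mono hsub _ (uTau_mem_wordSpan (hp (q + 1))))
        have := hp q
        rwa [show (J.length : ℤ) - q = J.length - (q + 1 : ℕ) + 1 by push_cast; ring] at this
    · simp
  · rintro _ ⟨K, h1, h2, rfl⟩
    refine ⟨K ++ [j], h1.append (List.Sublist.refl _), fun i hi hne => ?_, by simp⟩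
    rcases List.mem_append.mp hi with hi | hi
    · exact List.mem_append_left _ (h2 i hi hne)
    · exact List.mem_append_right _ hi

theorem coeff_prod_tauMatrix_mem {n : ℕ} (σ : Equiv.Perm (Fin n)) (K J : List (Fin n))
    (p : (UMinus n)[X])
    (hp : ∀ q : ℕ, p.coeff q ∈ wordSpan (columnPairs σ J) ((J.length : ℤ) - q)) (q : ℕ) :
    (((K.map fun j => tauMatrix n (σ j) j).prod.unop p).coeff q)
      ∈ wordSpan (columnPairs σ (J ++ K)) (((J ++ K).length : ℤ) - q) := by
  induction K generalizing J p with
  | nil => simpa using hp q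
  | cons j K ih =>
    -- In the opposite ring the leftmost factor acts first, so column `j` is absorbed into the
    -- processed list `J`.
    rw [List.map_cons, List.prod_cons, MulOpposite.unop_mul, Module.End.mul_apply,
      List.append_cons]
    exact ih _ _ (coeff_tauMatrix_mem σ j J p hp)

theorem segalSugawara_mem_wordSpan {n ℓ : ℕ} (hℓ : ℓ ≤ n) :
    segalSugawara n ℓ ∈ wordSpan {P | Balanced P} ℓ := by
  rw [segalSugawara, columnDet, Finset.unop_sum, LinearMap.sum_apply, Polynomial.finsetSum_coeff]
  refine sum_mem fun σ _ => ?_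
  rw [MulOpposite.unop_smul, LinearMap.smul_apply, Polynomial.coeff_smul]
  refine zsmul_mem ?_ _
  -- Starting from `1` and the empty list, all `n` columns give weight `n - q` at `τ^q`; for `q = n
  -- - ℓ` this is `ℓ`.
  have h := coeff_prod_tauMatrix_mem σ (List.finRange n) [] 1 (fun q => ?_) (n - ℓ)
  · rw [List.nil_append, List.length_finRange, Nat.cast_sub hℓ, sub_sub_cancel] at h
    rw [List.ofFn_eq_map]
    exact wordSpan_mono (fun P hP => balanced_of_mem_columnPairs σ hP) _ h
  · rw [Polynomial.coeff_one]
    split_ifs with hq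
    · subst hq
      have := word_mem_wordSpan (C := columnPairs σ []) (w := []) ⟨[], by simp⟩
      simpa [word, weight] using this
    · exact zero_mem _

/-! ### Vanishing of the Fourier coefficients -/

theorem fourierCoeff_apply_eq_zero {n : ℕ} {c : ℂ} {M : Type*} [AddCommGroup M] [Module ℂ M]
    [LieRingModule (Affine n c) M] [LieModule ℂ (Affine n c) M] [IsSmooth n c M]
    {C : Set (List (Fin n × Fin n))} {d N : ℤ} {v : M} {a : UMinus n}
    (h : ∀ w : List ((Fin n × Fin n) × ℕ), w.map Prod.fst ∈ C → weight w = d →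
      ncoeff (wordField c M w) N v = 0) (ha : a ∈ wordSpan C d) :
    fourierCoeff n c M a N v = 0 := by
  refine Submodule.span_induction (p := fun a _ => fourierCoeff n c M a N v = 0) ?_ ?_ ?_ ?_ ha
  · rintro _ ⟨w, h1, h2, rfl⟩
    rw [fourierCoeff, stateField_word, h w h1 h2]
  · simp [fourierCoeff]
  · intro a b _ _ ha hb
    rw [fourierCoeff] at ha hb ⊢
    rw [map_add, map_add, Pi.add_apply, LinearMap.add_apply, ha, hb, add_zero]
  · intro r a _ ha
    rw [fourierCoeff] at ha ⊢
    rw [map_smul, map_smul, Pi.smul_apply, LinearMap.smul_apply, ha, smul_zero]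

/-- By linearity only balanced words of weight `ℓ` matter. For `m = 0` the bound gives `N ≥ ℓ - 1 ≥
0` and the vacuum argument applies; for `m ≥ 1` the degree `N + 1 - ℓ` is at least `m`. -/
theorem fourierCoeff_segalSugawara_eq_zero {n : ℕ} {c : ℂ} {M : Type*} [AddCommGroup M]
    [Module ℂ M] [LieRingModule (Affine n c) M] [LieModule ℂ (Affine n c) M] [IsSmooth n c M]
    (hone : ∀ w : M, ⁅central n c, w⁆ = w) {m : ℕ} {v : M}
    (hv : ∀ X ∈ rootSubspace n m, ⁅ofLoop n c X, v⁆ = 0) {ℓ : ℕ} (hℓ : 1 ≤ ℓ) (hn : ℓ ≤ n)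
    {N : ℤ} (hN : (m : ℤ) + ℓ - 1 ≤ N) : fourierCoeff n c M (segalSugawara n ℓ) N v = 0 := by
  refine fourierCoeff_apply_eq_zero (fun w hw hd => ?_) (segalSugawara_mem_wordSpan hn)
  rcases Nat.eq_zero_or_pos m with rfl | hm
  · exact ncoeff_wordField_eq_zero (lie_eq_zero_of_vanishesBelow_zero hone hv) w N
      (by push_cast at hN; omega)
  · have h := modeProd_wordField_eq_zero (m := (m : ℤ))
      (modeProd_apply_eq_zero hone (by omega) hm hv) w [] [] N (by simpa using hw)
      (by simp; omega)
    simpa [modeProd_nil] using h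

theorem vanishesBelow_mem_rootSubspace {n m : ℕ} {X : Loop n}
    (hX : VanishesBelow ((m + 1 : ℕ) : ℤ) X) : X ∈ rootSubspace n m := by
  intro i j k hk
  refine hX i j k (hk.trans_le ?_)
  rw [rootFunction]
  split_ifs <;> push_cast <;> omega

end

end AffineGL

theorem proposition4p3 (n : ℕ) (c : ℂ) (M : Type*) [AddCommGroup M] [Module ℂ M]
    [LieRingModule (AffineGL.Affine n c) M] [LieModule ℂ (AffineGL.Affine n c) M]
    (hone : ∀ w : M, ⁅AffineGL.central n c, w⁆ = w) (m : ℕ) (v : M)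
    (hv : ∀ X ∈ AffineGL.rootSubspace n m, ⁅AffineGL.ofLoop n c X, v⁆ = 0) :
    ∃ hsm : v ∈ AffineGL.smoothPart n c M, ∀ ℓ : ℕ, 1 ≤ ℓ → ℓ ≤ n →
      ∀ N : ℤ, (m : ℤ) + ℓ - 1 ≤ N →
        AffineGL.fourierCoeff n c (AffineGL.smoothPart n c M) (AffineGL.segalSugawara n ℓ) N
          ⟨v, hsm⟩ = 0 := by
  refine ⟨⟨m + 1, fun X hX => hv X (AffineGL.vanishesBelow_mem_rootSubspace hX)⟩,
    fun ℓ hℓ hn N hN => ?_⟩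
  -- The smooth part is a submodule, so both the action of the centre and the annihilation of `v`
  -- restrict to it.
  exact AffineGL.fourierCoeff_segalSugawara_eq_zero (fun w => Subtype.ext (hone w))
    (fun X hX => Subtype.ext (hv X hX)) hℓ hn hN
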